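/- Let $q\in\mathbb N$, let $P$ be a transition probability kernel on $\mathbb R^q$, let $h:\mathbb R^q\to\mathbb R^q$ be a measurable map, and let $\xi$ be a probability measure on $\mathbb R^q$. For a probability measure $\mu$ on $\mathbb R^q$, let $\mathbf P^\mu$ be the law on $(\mathbb R^q)^{\mathbb Z_+}\times(\mathbb R^q)^{\mathbb Z_+}$, with coordinate processes $(X_n)_{n\ge 0}$ and $(Y_n)_{n\ge 0}$, under which $(X_n)_{n\ge0}$ is a Markov chain with initial law $\mu$ and transition kernel $P$, and $Y_n=h(X_n)+\xi_n$ for all $n\ge 0$, where $(\xi_n)_{n\ge0}$ is an i.i.d. sequence with law $\xi$ that is independent of $(X_n)_{n\ge0}$. Let $\pi_n^\mu:=\mathbf P^\mu(X_{n+1}\in\cdot\mid Y_0,\dots,Y_n)$, $n\ge0$, be (any versions of) the regular conditional probabilities, that is, the one-step predictors. For probability measures $\rho,\rho'$ on $\mathbb R^q$ put $$\|\rho-\rho'\|_{\mathrm{BL}}:=\sup\Big\{\Big|\int f\,d\rho-\int f\,d\rho'\Big| : f:\mathbb R^q\to\mathbb R,\ \sup_x|f(x)|\le 1,\ |f(x)-f(y)|\le\|x-y\|\text{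 for all }x,y\Big\}.$$ Suppose that 1. $h$ possesses a uniformly continuous inverse, that is, $h$ is injective and $h^{-1}:h(\mathbb R^q)\to\mathbb R^q$ is uniformly continuous; and 2. the characteristic function of $\xi$ (the law of $\xi_0$) vanishes nowhere. Then for all probability measures $\mu,\nu$ on $\mathbb R^q$ such that $\mathbf P^\mu|_{\sigma\{(Y_k)_{k\ge0}\}}\ll\mathbf P^\nu|_{\sigma\{(Y_k)_{k\ge0}\}}$, $$\|\pi_n^\mu-\pi_n^\nu\|_{\mathrm{BL}}\xrightarrow{n\to\infty}0,\qquad \mathbf P^\mu\text{-a.s.}$$ -/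

import Mathlib

open MeasureTheory ProbabilityTheory Filter Topology

/-- The set of test functions `Lip(S)`: real functions bounded by `1` with Lipschitz constant at
most `1`. -/
def LipBall (S : Type*) [PseudoMetricSpace S] : Set (S → ℝ) :=
  {f | (∀ x, |f x| ≤ 1) ∧ LipschitzWith 1 f}

/-- The dual bounded-Lipschitz distance `‖ρ - ρ'‖_BL`, the supremum of `|∫ f dρ - ∫ f dρ'|` over
`f ∈ Lip(S)`. For probability measures it is a supremum of a nonempty set of reals that is bounded
by `2`, see `bddAbove_blDist`. -/
noncomputable def blDist {S : Type*} [PseudoMetricSpace S] [MeasurableSpace S]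
    (ρ ρ' : Measure S) : ℝ :=
  ⨆ f : LipBall S, |(∫ x, (f : S → ℝ) x ∂ρ) - ∫ x, (f : S → ℝ) x ∂ρ'|

theorem bddAbove_blDist {S : Type*} [PseudoMetricSpace S] [MeasurableSpace S]
    (ρ ρ' : Measure S) [IsProbabilityMeasure ρ] [IsProbabilityMeasure ρ'] :
    BddAbove (Set.range fun f : LipBall S =>
      |(∫ x, (f : S → ℝ) x ∂ρ) - ∫ x, (f : S → ℝ) x ∂ρ'|) := by
  refine ⟨2, ?_⟩
  rintro _ ⟨f, rfl⟩
  have key : ∀ (m : Measure S) [IsProbabilityMeasure m], |∫ x, (f : S → ℝ) x ∂m| ≤ 1 := by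
    intro m _
    have := norm_integral_le_of_norm_le_const (μ := m) (f := (f : S → ℝ)) (C := 1)
      (Eventually.of_forall fun x => by simpa using f.2.1 x)
    simpa using this
  have h1 := key ρ
  have h2 := key ρ'
  rw [abs_le] at h1 h2
  simp only
  rw [abs_le]
  constructor <;> linarith

/-- The law on the sequence space of the time-homogeneous Markov chain with initial law `μ` and
transition kernel `K`. -/
noncomputable def chainLaw {E : Type*} [MeasurableSpace E] (K : Kernel E E) [IsMarkovKernel K]
    (μ : Measure E) : Measure (ℕ → E) :=
  Kernel.trajMeasure (X := fun _ => E) μ fun n =>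
    K.comap (fun x : (∀ _ : Finset.Iic n, E) => x ⟨n, Finset.mem_Iic.2 le_rfl⟩)
      (measurable_pi_apply _)

/-- The joint law `P^μ` of signal and observations `((X_n)_n, (Y_n)_n)` on the sequence space
`E^ℕ × E^ℕ`: the signal `X` is the Markov chain with initial law `μ` and transition kernel `K`,
the noise `(ξ_n)_n` is i.i.d. with law `ξ` and independent of `X`, and `Y_n = h (X_n) + ξ_n`. -/
noncomputable def hmmLaw {E : Type*} [MeasurableSpace E] [Add E] (K : Kernel E E)
    [IsMarkovKernel K] (h : E → E) (ξ : Measure E) [IsProbabilityMeasure ξ] (μ : Measure E) :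
    Measure ((ℕ → E) × (ℕ → E)) :=
  ((chainLaw K μ).prod (Measure.infinitePi fun _ : ℕ => ξ)).map
    fun p => (p.1, fun n => h (p.1 n) + p.2 n)

/-- The observation history `(Y_0, …, Y_n)` on the canonical space. -/
def obsHistory {E : Type*} (n : ℕ) (ω : (ℕ → E) × (ℕ → E)) : Finset.Iic n → E :=
  fun i => ω.2 i

/-- `π` is, for each `n`, a regular version of the conditional law of `X_{n+1}` given
`Y_0, …, Y_n` under the law `P` on the canonical space, written as a Markov kernel
`π n` evaluated at the observation history. -/
structure IsOneStepPredictor {E : Type*} [MeasurableSpace E] (P : Measure ((ℕ → E) × (ℕ → E)))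
    (π : (n : ℕ) → Kernel (Finset.Iic n → E) E) : Prop where
  isMarkovKernel : ∀ n, IsMarkovKernel (π n)
  hasCondDistrib : ∀ n,
    HasCondDistrib (fun ω : (ℕ → E) × (ℕ → E) => ω.1 (n + 1)) (obsHistory n) (π n) P

/-! The proof combines a probabilistic merging statement for the observations with a deterministic
deconvolution estimate that transfers it to the signal.

Merging: given `Y_0, …, Y_n`, the predictive law of `Y_{n+1}` is the image of the predictor under
`h`, convolved with `ξ`. Let `Λ` be the density of the `μ`-law of the observations with respect to
the `ν`-law. By Bayes' formula, two predictive means of a function bounded by `1` differ by at most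
`E_ν[|Λ - Λ_n| | Y_0, …, Y_n] / Λ_n`, where `Λ_n = E_ν[Λ | Y_0, …, Y_n]`. This bound does not depend
on the function and tends to `0` almost surely under `μ`, by Lévy's upward theorem
(`ae_exists_tendsto_zero_abs_sub_le`).

Deconvolution: the predictors need not be tight, so the estimate must be uniform over all pairs of
probability measures. By duality it suffices to approximate every `f` in the Lipschitz ball,
uniformly on the space, by `x ↦ ∫ g (x + z) dξ(z)` with a common bound on the size and Lipschitz
constant of `g`. Smoothing `f` by a band-limited kernel costs a small uniform error. A Wiener-type
argument then factors the smoothing operator through averaging by `ξ`: near a frequency `c`,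
averaging is almost multiplication by a nonzero value of the characteristic function, so a Neumann
series inverts it, and compactness of the band patches finitely many such inverses
(`avgFactor_kernelOp`). The other factor commutes with translations, hence keeps Lipschitz bounds.

Finally, uniform continuity of the inverse of `h` makes every `f` uniformly close to `L * F ∘ h`
with `F` in the Lipschitz ball and `L` independent of `f`, which replaces the law of `h(X)` by that
of `X`. -/

/-! ### Division in a Banach algebra by a Neumann series -/

/-- With `W = B - c • (T * B)`, the relation `B * A = A` gives `(1 - W) * A = c • (T * A)`, and `1 -
W` is invertible. So `T` need only be nearly invertible on the part of the algebra where `B` acts as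
a unit. -/
theorem exists_factor_of_approx_unit {R : Type*} [NormedRing R] [NormedAlgebra ℂ R]
    [CompleteSpace R] {T A B : R} {c : ℂ} {S : Set R} (hTS : ∀ s ∈ S, Commute T s)
    (hA : ∀ s ∈ S, Commute A s) (hB : ∀ s ∈ S, Commute B s) (hT : Commute B T) (hBA : B * A = A)
    (hnorm : ‖B - c • (T * B)‖ < 1) : ∃ G : R, (∀ s ∈ S, Commute G s) ∧ A = T * G := by
  set W := B - c • (T * B) with hW
  obtain ⟨U, hU⟩ := isUnit_one_sub_of_norm_lt_one hnorm
  have hWS : ∀ s ∈ S, Commute (1 - W) s := fun s hs =>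
    (Commute.one_left _).sub_left
      ((hB s hs).sub_left (((hTS s hs).mul_left (hB s hs)).smul_left c))
  have hWT : Commute (1 - W) T :=
    (Commute.one_left _).sub_left (hT.sub_left (((Commute.refl _).mul_left hT).smul_left c))
  refine ⟨c • (((U⁻¹ : Rˣ) : R) * A), fun s hs => ?_, ?_⟩
  · exact Commute.smul_left (Commute.mul_left (Commute.units_inv_left (hU ▸ hWS s hs)) (hA s hs)) c
  · have h1 : (1 - W) * A = c • (T * A) := by
      rw [hW, sub_mul, sub_mul, one_mul, hBA, smul_mul_assoc, mul_assoc, hBA]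
      abel
    have h2 : Commute ((U⁻¹ : Rˣ) : R) T := Commute.units_inv_left (hU ▸ hWT)
    rw [mul_smul_comm, ← mul_assoc, ← h2.eq, mul_assoc, ← mul_smul_comm, ← h1, ← hU,
      Units.inv_mul_cancel_left]

/-! ### Translation-invariant operators on bounded continuous functions -/

section Correlation

open scoped BoundedContinuousFunction

variable {E : Type*} [NormedAddCommGroup E] [MeasurableSpace E] [BorelSpace E]
  [SecondCountableTopology E]

theorem integrable_mul_boundedContinuous {m : Measure E} {φ : E → ℂ} (hφ : Integrable φ m)
    (u : E →ᵇ ℂ) (x : E) : Integrable (fun z => φ z * u (x + z)) m :=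
  hφ.mul_bdd (c := ‖u‖) (by fun_prop) (Eventually.of_forall fun z => u.norm_coe_le_norm _)

omit [BorelSpace E] [SecondCountableTopology E] in
theorem norm_integral_mul_boundedContinuous_le {m : Measure E} {φ : E → ℂ} (hφ : Integrable φ m)
    (u : E →ᵇ ℂ) (x : E) : ‖∫ z, φ z * u (x + z) ∂m‖ ≤ (∫ z, ‖φ z‖ ∂m) * ‖u‖ := by
  rw [← integral_mul_const]
  refine norm_integral_le_of_norm_le (hφ.norm.mul_const _) (Eventually.of_forall fun z => ?_)
  rw [norm_mul]
  gcongr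
  exact u.norm_coe_le_norm _

/-- The operator `u ↦ (x ↦ ∫ φ z * u (x + z) dm(z))` on bounded continuous functions. -/
noncomputable def corr (m : Measure E) (φ : E → ℂ) (hφ : Integrable φ m) :
    (E →ᵇ ℂ) →L[ℂ] (E →ᵇ ℂ) :=
  LinearMap.mkContinuous
    { toFun := fun u => BoundedContinuousFunction.ofNormedAddCommGroup
        (fun x => ∫ z, φ z * u (x + z) ∂m)
        (by
          refine continuous_of_dominated (bound := fun z => ‖φ z‖ * ‖u‖)
            (fun x => (integrable_mul_boundedContinuous hφ u x).aestronglyMeasurable) ?_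
            (hφ.norm.mul_const _) (Eventually.of_forall fun z => by fun_prop)
          intro x
          refine Eventually.of_forall fun z => ?_
          rw [norm_mul]
          gcongr
          exact u.norm_coe_le_norm _)
        ((∫ z, ‖φ z‖ ∂m) * ‖u‖) (norm_integral_mul_boundedContinuous_le hφ u)
      map_add' := fun u v => by
        ext x
        simp only [BoundedContinuousFunction.coe_ofNormedAddCommGroup,
          BoundedContinuousFunction.coe_add, Pi.add_apply, mul_add]
        exact integral_add (integrable_mul_boundedContinuous hφ u x)
          (integrable_mul_boundedContinuous hφ v x)
      map_smul' := fun c u => by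
        ext x
        simp only [BoundedContinuousFunction.coe_ofNormedAddCommGroup,
          BoundedContinuousFunction.coe_smul, smul_eq_mul, RingHom.id_apply, mul_left_comm _ c]
        exact integral_const_mul _ _ }
    (∫ z, ‖φ z‖ ∂m)
    (fun u => (BoundedContinuousFunction.norm_le (by positivity)).2
      (norm_integral_mul_boundedContinuous_le hφ u))

theorem corr_apply {m : Measure E} {φ : E → ℂ} (hφ : Integrable φ m) (u : E →ᵇ ℂ) (x : E) :
    corr m φ hφ u x = ∫ z, φ z * u (x + z) ∂m := rfl

/-- Fubini and commutativity of addition. Translations and averaging are correlations too, so this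
one lemma supplies every commutation relation needed later. -/
theorem corr_comm {m m' : Measure E} [SFinite m] [SFinite m'] {φ φ' : E → ℂ}
    (hφ : Integrable φ m) (hφ' : Integrable φ' m') :
    Commute (corr m φ hφ) (corr m' φ' hφ') := by
  refine ContinuousLinearMap.ext fun u => BoundedContinuousFunction.ext fun x => ?_
  simp only [mul_apply_eq_comp, corr_apply, ← integral_const_mul]
  rw [integral_integral_swap]
  · refine integral_congr_ae (Eventually.of_forall fun w => integral_congr_ae
      (Eventually.of_forall fun z => ?_))
    simp only [add_right_comm x w z]
    ring
  · have h1 : Integrable (fun p : E × E => φ p.1 * φ' p.2 * u (x + p.1 + p.2)) (m.prod m') :=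
      (hφ.mul_prod hφ').mul_bdd (c := ‖u‖) (by fun_prop)
        (Eventually.of_forall fun z => u.norm_coe_le_norm _)
    simpa only [Function.uncurry_def, mul_assoc] using h1

/-- Translation by `y` as an operator on bounded continuous functions. -/
noncomputable def shiftOp (y : E) : (E →ᵇ ℂ) →L[ℂ] (E →ᵇ ℂ) :=
  corr (Measure.dirac y) (fun _ => 1) (integrable_const _)

theorem shiftOp_apply (y : E) (u : E →ᵇ ℂ) (x : E) : shiftOp y u x = u (x + y) := by
  rw [shiftOp, corr_apply, integral_dirac]
  simp

/-- Averaging with respect to `ξ` as an operator on bounded continuous functions. -/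
noncomputable def avg (ξ : Measure E) [IsProbabilityMeasure ξ] : (E →ᵇ ℂ) →L[ℂ] (E →ᵇ ℂ) :=
  corr ξ (fun _ => 1) (integrable_const _)

theorem avg_apply (ξ : Measure E) [IsProbabilityMeasure ξ] (u : E →ᵇ ℂ) (x : E) :
    avg ξ u x = ∫ z, u (x + z) ∂ξ := by
  simp [avg, corr_apply]

/-- `S` factors through `avg ξ` by an operator that commutes with translations. -/
def AvgFactor (ξ : Measure E) [IsProbabilityMeasure ξ] (S : (E →ᵇ ℂ) →L[ℂ] (E →ᵇ ℂ)) : Prop :=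
  ∃ G : (E →ᵇ ℂ) →L[ℂ] (E →ᵇ ℂ), (∀ y, Commute G (shiftOp y)) ∧ S = avg ξ * G

theorem AvgFactor.add {ξ : Measure E} [IsProbabilityMeasure ξ]
    {S S' : (E →ᵇ ℂ) →L[ℂ] (E →ᵇ ℂ)} (hS : AvgFactor ξ S) (hS' : AvgFactor ξ S') :
    AvgFactor ξ (S + S') := by
  obtain ⟨G, hG, rfl⟩ := hS
  obtain ⟨G', hG', rfl⟩ := hS'
  exact ⟨G + G', fun y => (hG y).add_left (hG' y), (mul_add _ _ _).symm⟩

theorem AvgFactor.zero {ξ : Measure E} [IsProbabilityMeasure ξ] :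
    AvgFactor ξ (0 : (E →ᵇ ℂ) →L[ℂ] (E →ᵇ ℂ)) :=
  ⟨0, fun _ => Commute.zero_left _, (mul_zero _).symm⟩

theorem avgFactor_of_approx_unit {ξ : Measure E} [IsProbabilityMeasure ξ]
    {A B : (E →ᵇ ℂ) →L[ℂ] (E →ᵇ ℂ)} {c : ℂ} (hA : ∀ y, Commute A (shiftOp y))
    (hB : ∀ y, Commute B (shiftOp y)) (hT : Commute B (avg ξ)) (hBA : B * A = A)
    (hnorm : ‖B - c • (avg ξ * B)‖ < 1) : AvgFactor ξ A := by
  obtain ⟨G, hG, h⟩ := exists_factor_of_approx_unit (T := avg ξ) (S := Set.range shiftOp)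
    (by rintro _ ⟨y, rfl⟩; exact corr_comm _ _) (by rintro _ ⟨y, rfl⟩; exact hA y)
    (by rintro _ ⟨y, rfl⟩; exact hB y) hT hBA hnorm
  exact ⟨G, fun y => hG _ ⟨y, rfl⟩, h⟩

end Correlation

/-! ### Kernels localised in frequency -/

section Schwartz

open scoped BoundedContinuousFunction FourierTransform SchwartzMap ContDiff

variable {E : Type*} [NormedAddCommGroup E] [InnerProductSpace ℝ E] [FiniteDimensional ℝ E]
  [MeasurableSpace E] [BorelSpace E]

/-- The operator `u ↦ (x ↦ ∫ φ z * u (x + z) dz)` for a Schwartz function `φ`. -/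
noncomputable def kernelOp (φ : 𝓢(E, ℂ)) : (E →ᵇ ℂ) →L[ℂ] (E →ᵇ ℂ) :=
  corr volume φ φ.integrable

theorem kernelOp_apply (φ : 𝓢(E, ℂ)) (u : E →ᵇ ℂ) (x : E) :
    kernelOp φ u x = ∫ z, φ z * u (x + z) := rfl

theorem kernelOp_add (φ ψ : 𝓢(E, ℂ)) : kernelOp (φ + ψ) = kernelOp φ + kernelOp ψ := by
  refine ContinuousLinearMap.ext fun u => BoundedContinuousFunction.ext fun x => ?_
  simp only [kernelOp_apply, add_apply, BoundedContinuousFunction.coe_add,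
    Pi.add_apply, add_mul]
  exact integral_add (integrable_mul_boundedContinuous φ.integrable u x)
    (integrable_mul_boundedContinuous ψ.integrable u x)

theorem integral_mul_sub_eq_of_fourier_mul_eq {κ φ : 𝓢(E, ℂ)}
    (h : ∀ t, 𝓕 κ t * 𝓕 φ t = 𝓕 φ t) (w : E) : ∫ z, κ z * φ (w - z) = φ w := by
  have h1 : SchwartzMap.convolution (ContinuousLinearMap.mul ℂ ℂ) κ φ = φ := by
    have h2 : 𝓕 (SchwartzMap.convolution (ContinuousLinearMap.mul ℂ ℂ) κ φ) = 𝓕 φ := by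
      rw [SchwartzMap.fourier_convolution]
      ext t
      simpa using h t
    have := congrArg 𝓕⁻ h2
    simpa using this
  have h3 := SchwartzMap.convolution_apply (ContinuousLinearMap.mul ℂ ℂ) κ φ w
  rw [h1] at h3
  exact h3.symm

/-- Composing the operators convolves the kernels, which multiplies the Fourier transforms. A kernel
whose transform is `1` on the support of `𝓕 φ` is thus a unit for `kernelOp φ`. -/
theorem kernelOp_mul_eq_of_fourier_mul_eq {κ φ : 𝓢(E, ℂ)}
    (h : ∀ t, 𝓕 κ t * 𝓕 φ t = 𝓕 φ t) : kernelOp κ * kernelOp φ = kernelOp φ := by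
  refine ContinuousLinearMap.ext fun u => BoundedContinuousFunction.ext fun x => ?_
  simp only [mul_apply_eq_comp, kernelOp_apply]
  have hint : Integrable (fun p : E × E => κ p.2 * φ (p.1 - p.2) * u (x + p.1))
      (volume.prod volume) := by
    have := (κ.integrable (μ := volume)).convolution_integrand (ContinuousLinearMap.mul ℂ ℂ)
      (φ.integrable (μ := volume))
    exact this.mul_bdd (c := ‖u‖) (by fun_prop) (Eventually.of_forall fun z => u.norm_coe_le_norm _)
  calc ∫ z, κ z * ∫ w, φ w * u (x + z + w)
      = ∫ z, ∫ w, κ z * φ (w - z) * u (x + w) := by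
        refine integral_congr_ae (Eventually.of_forall fun z => ?_)
        simp only [mul_assoc, integral_const_mul]
        rw [← integral_add_right_eq_self (fun w => φ (w - z) * u (x + w)) z]
        simp [add_assoc, add_comm z]
    _ = ∫ w, ∫ z, κ z * φ (w - z) * u (x + w) := (integral_integral_swap hint).symm
    _ = ∫ w, φ w * u (x + w) := by
        refine integral_congr_ae (Eventually.of_forall fun w => ?_)
        simp only [integral_mul_const]
        rw [integral_mul_sub_eq_of_fourier_mul_eq h]

/-- A smooth bump around `c`, equal to `1` on the ball of radius `r`, as a Schwartz function. -/
noncomputable def schwartzBump (c : E) (r : ℝ) (hr : 0 < r) : 𝓢(E, ℂ) :=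
  HasCompactSupport.toSchwartzMap
    (f := fun t => (((⟨r, 2 * r, hr, by linarith⟩ : ContDiffBump c) t : ℝ) : ℂ))
    ((⟨r, 2 * r, hr, by linarith⟩ : ContDiffBump c).hasCompactSupport.comp_left
      Complex.ofReal_zero)
    (Complex.ofRealCLM.contDiff.comp (ContDiffBump.contDiff _))

omit [MeasurableSpace E] [BorelSpace E] in
theorem schwartzBump_apply (c : E) (r : ℝ) (hr : 0 < r) (t : E) :
    schwartzBump c r hr t = (((⟨r, 2 * r, hr, by linarith⟩ : ContDiffBump c) t : ℝ) : ℂ) := rfl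

omit [MeasurableSpace E] [BorelSpace E] in
theorem schwartzBump_eq_one {c : E} {r : ℝ} (hr : 0 < r) {t : E} (ht : dist t c ≤ r) :
    schwartzBump c r hr t = 1 := by
  rw [schwartzBump_apply, ContDiffBump.one_of_mem_closedBall _ (by simpa using ht)]
  simp

omit [MeasurableSpace E] [BorelSpace E] in
theorem schwartzBump_eq_zero {c : E} {r : ℝ} (hr : 0 < r) {t : E} (ht : 2 * r ≤ dist t c) :
    schwartzBump c r hr t = 0 := by
  rw [schwartzBump_apply, ContDiffBump.zero_of_le_dist _ ht]
  simp

omit [MeasurableSpace E] [BorelSpace E] in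
theorem schwartzBump_rescale (c : E) {r : ℝ} (hr : 0 < r) (s : E) :
    schwartzBump c r hr (c + r • s) = schwartzBump 0 1 one_pos s := by
  simp only [schwartzBump_apply, ContDiffBump.apply]
  congr 2
  · field_simp
  · simp [smul_smul, hr.ne']

/-- The kernel whose Fourier transform is the bump around `c` at scale `r`. -/
noncomputable def bumpKernel (c : E) (r : ℝ) (hr : 0 < r) : 𝓢(E, ℂ) := 𝓕⁻ (schwartzBump c r hr)

theorem fourier_bumpKernel (c : E) (r : ℝ) (hr : 0 < r) :
    𝓕 (bumpKernel c r hr) = schwartzBump c r hr := by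
  simp [bumpKernel]

theorem bumpKernel_apply (c : E) {r : ℝ} (hr : 0 < r) (z : E) :
    bumpKernel c r hr z = (r ^ Module.finrank ℝ E : ℝ) *
      (Complex.exp (2 * Real.pi * inner ℝ c z * Complex.I) * bumpKernel 0 1 one_pos (r • z)) := by
  have key : ∀ (c : E) (r : ℝ) (hr : 0 < r) (z : E), bumpKernel c r hr z =
      ∫ v, Complex.exp (2 * Real.pi * inner ℝ v z * Complex.I) * schwartzBump c r hr v := by
    intro c r hr z
    rw [bumpKernel, SchwartzMap.fourierInv_coe, Real.fourierInv_eq']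
    simp
  rw [key, key, ← integral_add_left_eq_self _ c]
  have := Measure.integral_comp_smul (volume : Measure E) (fun v =>
    Complex.exp (2 * Real.pi * inner ℝ (c + v) z * Complex.I) * schwartzBump c r hr (c + v)) r
  rw [abs_of_pos (by positivity)] at this
  rw [eq_comm, inv_smul_eq_iff₀ (by positivity)] at this
  rw [this, Complex.real_smul]
  congr 1
  rw [← integral_const_mul]
  refine integral_congr_ae (Eventually.of_forall fun v => ?_)
  simp only [schwartzBump_rescale]
  rw [← mul_assoc, ← Complex.exp_add]
  congr 2
  simp only [inner_add_left, inner_smul_left, inner_smul_right]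
  push_cast
  simp
  ring

theorem norm_exp_two_pi_inner (a : ℝ) : ‖Complex.exp (2 * Real.pi * a * Complex.I)‖ = 1 := by
  have := Complex.norm_exp_ofReal_mul_I (2 * Real.pi * a)
  push_cast at this
  exact this

/-- The `L¹` modulus of continuity of the unit bump kernel. -/
noncomputable def bumpModulus (y : E) : ℝ :=
  ∫ z, ‖bumpKernel 0 1 one_pos (z - y) - bumpKernel (0 : E) 1 one_pos z‖

/-- The kernel is a character of frequency `c` times a dilate of the unit kernel. Translation by `y`
turns the character into a phase and moves the dilate by `r • y` in unit scale, so for small `r` the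
kernel is almost an eigenfunction of translation. -/
theorem integral_norm_bumpKernel_sub (c : E) {r : ℝ} (hr : 0 < r) (y : E) :
    ∫ z, ‖bumpKernel c r hr (z - y) -
      Complex.exp (2 * Real.pi * inner ℝ c (-y) * Complex.I) * bumpKernel c r hr z‖ =
    bumpModulus (r • y) := by
  have h1 : ∀ z, ‖bumpKernel c r hr (z - y) -
      Complex.exp (2 * Real.pi * inner ℝ c (-y) * Complex.I) * bumpKernel c r hr z‖ =
      r ^ Module.finrank ℝ E *
        ‖bumpKernel 0 1 one_pos (r • z - r • y) - bumpKernel (0 : E) 1 one_pos (r • z)‖ := by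
    intro z
    rw [bumpKernel_apply c hr, bumpKernel_apply c hr z, smul_sub]
    have : Complex.exp (2 * Real.pi * inner ℝ c (z - y) * Complex.I) =
        Complex.exp (2 * Real.pi * inner ℝ c (-y) * Complex.I) *
        Complex.exp (2 * Real.pi * inner ℝ c z * Complex.I) := by
      rw [← Complex.exp_add]
      congr 1
      simp only [inner_sub_right, inner_neg_right]
      push_cast
      ring
    rw [this]
    have h2 : ∀ a b d e f : ℂ, a * (b * d * e) - b * (a * (d * f)) = a * (b * (d * (e - f))) := by
      intros; ring
    rw [h2, norm_mul, norm_mul, norm_mul, norm_exp_two_pi_inner, norm_exp_two_pi_inner, one_mul,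
      one_mul, Complex.norm_real, Real.norm_of_nonneg (by positivity)]
  simp_rw [h1]
  rw [integral_const_mul]
  have := Measure.integral_comp_smul (volume : Measure E) (fun z =>
    ‖bumpKernel 0 1 one_pos (z - r • y) - bumpKernel (0 : E) 1 one_pos z‖) r
  rw [this, abs_of_pos (by positivity), smul_eq_mul, mul_inv_cancel_left₀ (by positivity)]
  rfl

theorem integrable_bumpKernel_sub_sub (y : E) :
    Integrable fun z => bumpKernel 0 1 one_pos (z - y) - bumpKernel (0 : E) 1 one_pos z :=
  ((SchwartzMap.integrable _).comp_sub_right y).sub (SchwartzMap.integrable _)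

theorem bumpModulus_le (y : E) :
    bumpModulus y ≤ 2 * ∫ z, ‖bumpKernel (0 : E) 1 one_pos z‖ := by
  have hi : Integrable (bumpKernel (0 : E) 1 one_pos) := SchwartzMap.integrable _
  calc bumpModulus y ≤ ∫ z, (‖bumpKernel 0 1 one_pos (z - y)‖ +
        ‖bumpKernel (0 : E) 1 one_pos z‖) :=
        integral_mono (integrable_bumpKernel_sub_sub y).norm
          ((hi.comp_sub_right y).norm.add hi.norm) fun z => norm_sub_le _ _
    _ = _ := by
        rw [integral_add (hi.comp_sub_right y).norm hi.norm,
          integral_sub_right_eq_self fun z => ‖bumpKernel (0 : E) 1 one_pos z‖]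
        ring

theorem bumpModulus_nonneg (y : E) : 0 ≤ bumpModulus y := integral_nonneg fun _ => norm_nonneg _

theorem continuous_bumpModulus : Continuous (bumpModulus : E → ℝ) := by
  let f : 𝓢(E, ℂ) := bumpKernel (0 : E) 1 one_pos
  have hf : MemLp f 1 volume := f.memLp 1
  -- The modulus is the norm of an orbit difference in `L¹`, where translations act continuously.
  have h1 : bumpModulus = fun y : E =>
      ‖(DomAddAct.mk (-y) +ᵥ hf.toLp f) - hf.toLp f‖ := by
    ext y
    rw [L1.norm_eq_integral_norm, bumpModulus]
    refine integral_congr_ae ?_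
    filter_upwards [Lp.coeFn_sub (DomAddAct.mk (-y) +ᵥ hf.toLp f) (hf.toLp f),
      DomAddAct.vadd_Lp_ae_eq (DomAddAct.mk (-y)) (hf.toLp f), hf.coeFn_toLp,
      (measurePreserving_vadd (-y) (volume : Measure E)).quasiMeasurePreserving.ae hf.coeFn_toLp]
      with z h1 h2 h3 h4
    rw [h1, Pi.sub_apply, h2, h3]
    simp only [vadd_eq_add, Equiv.symm_apply_apply] at h4 ⊢
    rw [h4, neg_add_eq_sub]
  rw [h1]
  have : Fact ((1 : ENNReal) ≠ ⊤) := ⟨ENNReal.one_ne_top⟩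
  have : Continuous fun y : E => DomAddAct.mk (-y) +ᵥ hf.toLp f := by
    have h2 : Continuous fun y : E => DomAddAct.mk (-y) := by
      exact DomAddAct.continuous_mk.comp continuous_neg
    exact h2.vadd continuous_const
  fun_prop

theorem bumpModulus_zero : bumpModulus (0 : E) = 0 := by simp [bumpModulus]

end Schwartz

/-! ### Deconvolution when the characteristic function has no zeros -/

section Deconvolution

open scoped BoundedContinuousFunction FourierTransform SchwartzMap ContDiff

variable {E : Type*} [NormedAddCommGroup E] [InnerProductSpace ℝ E] [FiniteDimensional ℝ E]
  [MeasurableSpace E] [BorelSpace E]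

theorem integrable_bumpModulus_smul (ξ : Measure E) [IsProbabilityMeasure ξ] (r : ℝ) :
    Integrable (fun y => bumpModulus (r • y)) ξ :=
  Integrable.of_bound (C := 2 * ∫ z, ‖bumpKernel (0 : E) 1 one_pos z‖)
    (continuous_bumpModulus.comp (continuous_const_smul r)).aestronglyMeasurable
    (Eventually.of_forall fun y => by
      rw [Real.norm_of_nonneg (bumpModulus_nonneg _)]; exact bumpModulus_le _)

theorem tendsto_integral_bumpModulus (ξ : Measure E) [IsProbabilityMeasure ξ] :
    Tendsto (fun n : ℕ => ∫ y, bumpModulus ((1 / ((n : ℝ) + 1)) • y) ∂ξ) atTop (𝓝 0) := by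
  have h : ∫ _ : E, (0 : ℝ) ∂ξ = 0 := by simp
  rw [← h]
  refine tendsto_integral_of_dominated_convergence
    (fun _ => 2 * ∫ z, ‖bumpKernel (0 : E) 1 one_pos z‖)
    (fun n => (integrable_bumpModulus_smul ξ _).aestronglyMeasurable) (integrable_const _)
    (fun n => Eventually.of_forall fun y => ?_) (Eventually.of_forall fun y => ?_)
  · rw [Real.norm_of_nonneg (bumpModulus_nonneg _)]
    exact bumpModulus_le _
  · have h1 : Tendsto (fun n : ℕ => (1 / ((n : ℝ) + 1)) • y) atTop (𝓝 ((0 : ℝ) • y)) :=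
      tendsto_one_div_add_atTop_nhds_zero_nat.smul_const y
    rw [zero_smul] at h1
    have h2 := (continuous_bumpModulus (E := E)).tendsto 0
    rw [bumpModulus_zero] at h2
    exact h2.comp h1

omit [FiniteDimensional ℝ E] [BorelSpace E] in
theorem integral_exp_neg_inner_eq_charFun (ξ : Measure E) (c : E) :
    ∫ y, Complex.exp (2 * Real.pi * inner ℝ c (-y) * Complex.I) ∂ξ =
      charFun ξ (-(2 * Real.pi) • c) := by
  rw [charFun_apply]
  congr with y
  congr 1
  simp only [inner_neg_right, inner_smul_right, real_inner_comm]
  push_cast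
  ring

/-- Translating the argument of `u` amounts to translating the kernel, which is a phase up to
`bumpModulus (r • y)` in `L¹`. Integrating the phase over `ξ` gives the characteristic function; the
factor `-2π` reconciles the two Fourier conventions. -/
theorem norm_smul_kernelOp_sub_le (ξ : Measure E) [IsProbabilityMeasure ξ] (c : E) {r : ℝ}
    (hr : 0 < r) :
    ‖charFun ξ (-(2 * Real.pi) • c) • kernelOp (bumpKernel c r hr) -
      avg ξ * kernelOp (bumpKernel c r hr)‖ ≤ ∫ y, bumpModulus (r • y) ∂ξ := by
  have h0 : 0 ≤ ∫ y, bumpModulus (r • y) ∂ξ := integral_nonneg fun _ => bumpModulus_nonneg _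
  refine ContinuousLinearMap.opNorm_le_bound _ h0 fun u => ?_
  refine (BoundedContinuousFunction.norm_le (by positivity)).2 fun x => ?_
  let v := kernelOp (bumpKernel c r hr) u
  let e : E → ℂ := fun y => Complex.exp (2 * Real.pi * inner ℝ c (-y) * Complex.I)
  have he : Integrable e ξ := Integrable.of_bound (C := 1) (by fun_prop)
    (Eventually.of_forall fun y => (norm_exp_two_pi_inner _).le)
  have h1 : (charFun ξ (-(2 * Real.pi) • c) • kernelOp (bumpKernel c r hr) -
      avg ξ * kernelOp (bumpKernel c r hr)) u x = ∫ y, (e y * v x - v (x + y)) ∂ξ := by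
    rw [integral_sub (he.mul_const _), integral_mul_const, integral_exp_neg_inner_eq_charFun]
    · simp [avg_apply, v]
    · exact Integrable.of_bound (C := ‖v‖) (by fun_prop)
        (Eventually.of_forall fun y => v.norm_coe_le_norm _)
  rw [h1, ← integral_mul_const]
  refine norm_integral_le_of_norm_le ((integrable_bumpModulus_smul ξ r).mul_const _)
    (Eventually.of_forall fun y => ?_)
  have hK : Integrable (bumpKernel c r hr) := SchwartzMap.integrable _
  have h2 : v (x + y) = ∫ z, bumpKernel c r hr (z - y) * u (x + z) := by
    simp only [v, kernelOp_apply]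
    rw [← integral_sub_right_eq_self (fun z => bumpKernel c r hr z * u (x + y + z)) y]
    simp [add_assoc]
  have h3 : e y * v x = ∫ z, e y * bumpKernel c r hr z * u (x + z) := by
    simp only [v, kernelOp_apply, mul_assoc, integral_const_mul]
  have hi1 := integrable_mul_boundedContinuous (hK.const_mul (e y)) u x
  have hi2 := integrable_mul_boundedContinuous (hK.comp_sub_right y) u x
  rw [norm_sub_rev, h2, h3, ← integral_sub hi2 hi1, ← integral_norm_bumpKernel_sub c hr,
    ← integral_mul_const]
  refine norm_integral_le_of_norm_le
    (((hK.comp_sub_right y).sub (hK.const_mul (e y))).norm.mul_const _)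
    (Eventually.of_forall fun z => ?_)
  rw [← sub_mul, norm_mul]
  gcongr
  exact u.norm_coe_le_norm _

/-- As `r → 0` the error of replacing averaging by the scalar `a` tends to `0`, so it drops below
`‖a‖`. The Neumann series then applies with the bump kernel as local unit and `a⁻¹` as scalar. -/
theorem exists_avgFactor_kernelOp_near {ξ : Measure E} [IsProbabilityMeasure ξ]
    (hξ : ∀ t : E, charFun ξ t ≠ 0) (c : E) :
    ∃ r : ℝ, 0 < r ∧ ∀ φ : 𝓢(E, ℂ), (∀ t, 𝓕 φ t ≠ 0 → dist t c ≤ r) →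
      AvgFactor ξ (kernelOp φ) := by
  set a := charFun ξ (-(2 * Real.pi) • c) with ha
  have ha0 : a ≠ 0 := hξ _
  obtain ⟨n, hn⟩ := ((tendsto_integral_bumpModulus ξ).eventually
    (gt_mem_nhds (norm_pos_iff.2 ha0))).exists
  have hr : (0 : ℝ) < 1 / ((n : ℝ) + 1) := by positivity
  refine ⟨_, hr, fun φ hφ => ?_⟩
  refine avgFactor_of_approx_unit (B := kernelOp (bumpKernel c _ hr)) (c := a⁻¹)
    (fun y => corr_comm _ _) (fun y => corr_comm _ _) (corr_comm _ _)
    (kernelOp_mul_eq_of_fourier_mul_eq fun t => ?_) ?_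
  · rw [fourier_bumpKernel]
    by_cases ht : 𝓕 φ t = 0
    · rw [ht, mul_zero]
    · rw [schwartzBump_eq_one hr (hφ t ht), one_mul]
  · have h1 : kernelOp (bumpKernel c _ hr) - a⁻¹ • (avg ξ * kernelOp (bumpKernel c _ hr)) =
        a⁻¹ • (a • kernelOp (bumpKernel c _ hr) - avg ξ * kernelOp (bumpKernel c _ hr)) := by
      rw [smul_sub, inv_smul_smul₀ ha0]
    rw [h1]
    refine (ContinuousLinearMap.opNorm_smul_le _ _).trans_lt ?_
    rw [norm_inv, inv_mul_lt_one₀ (norm_pos_iff.2 ha0)]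
    exact (norm_smul_kernelOp_sub_le ξ c hr).trans_lt hn

theorem avgFactor_kernelOp {ξ : Measure E} [IsProbabilityMeasure ξ]
    (hξ : ∀ t : E, charFun ξ t ≠ 0) (φ : 𝓢(E, ℂ)) {S : Set E} (hS : IsCompact S)
    (hφ : ∀ t, 𝓕 φ t ≠ 0 → t ∈ S) : AvgFactor ξ (kernelOp φ) := by
  classical
  choose r hr hrφ using exists_avgFactor_kernelOp_near hξ
  -- Each factor removes from `φ` the frequencies near one centre, and each removed piece factors by
  -- the local result. A bump of radius `r i / 2` is supported within `r i`, as that result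
  -- requires; once the balls cover the band, nothing remains of `φ`.
  have key : ∀ s : Finset E, ∃ ψ : 𝓢(E, ℂ),
      (∀ t, 𝓕 ψ t = 𝓕 φ t * ∏ i ∈ s, (1 - schwartzBump i (r i / 2) (half_pos (hr i)) t)) ∧
      AvgFactor ξ (kernelOp (φ - ψ)) := by
    intro s
    induction s using Finset.induction_on with
    | empty =>
      refine ⟨φ, by simp, ?_⟩
      have : kernelOp (φ - φ) = 0 := by
        refine ContinuousLinearMap.ext fun u => BoundedContinuousFunction.ext fun x => ?_
        simp [kernelOp_apply]
      rw [this]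
      exact AvgFactor.zero
    | insert a s has ih =>
      obtain ⟨ψ, h1, h2⟩ := ih
      let χ : 𝓢(E, ℂ) := SchwartzMap.convolution (ContinuousLinearMap.mul ℂ ℂ)
        (bumpKernel a (r a / 2) (half_pos (hr a))) ψ
      have hχ : ∀ t, 𝓕 χ t = schwartzBump a (r a / 2) (half_pos (hr a)) t * 𝓕 ψ t := by
        intro t
        simp only [χ]
        rw [SchwartzMap.fourier_convolution, fourier_bumpKernel]
        simp
      refine ⟨ψ - χ, fun t => ?_, ?_⟩
      · have : 𝓕 (ψ - χ) = 𝓕 ψ - 𝓕 χ :=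
          (SchwartzMap.fourierTransformCLM ℂ).map_sub ψ χ
        rw [this, sub_apply, hχ, h1, Finset.prod_insert has]
        ring
      · have h3 : φ - (ψ - χ) = (φ - ψ) + χ := by abel
        rw [h3, kernelOp_add]
        refine h2.add (hrφ a χ fun t ht => ?_)
        rw [hχ] at ht
        by_contra! hlt
        exact ht (by rw [schwartzBump_eq_zero _ (by linarith), zero_mul])
  obtain ⟨s, -, hs⟩ := hS.elim_nhds_subcover (fun t => Metric.ball t (r t / 2))
    (fun t _ => Metric.ball_mem_nhds t (half_pos (hr t)))
  obtain ⟨ψ, h1, h2⟩ := key s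
  have h3 : 𝓕 ψ = 0 := by
    ext t
    rw [h1]
    by_cases ht : 𝓕 φ t = 0
    · simp [ht]
    · obtain ⟨i, hi, hti⟩ := Set.mem_iUnion₂.1 (hs (hφ t ht))
      rw [Finset.prod_eq_zero hi]
      · simp
      · rw [schwartzBump_eq_one _ (le_of_lt hti), sub_self]
  have h4 : ψ = 0 := by
    have := congrArg 𝓕⁻ h3
    simpa using this
  rwa [h4, sub_zero] at h2

/-- The kernel has integral `1`, the value of its Fourier transform at `0`, and its absolute first
moment scales like `1 / r`. -/
theorem exists_norm_kernelOp_bumpKernel_sub_le :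
    ∃ C : ℝ, ∀ (r : ℝ) (hr : 0 < r) (u : E →ᵇ ℂ), LipschitzWith 1 u → ∀ x,
      ‖kernelOp (bumpKernel 0 r hr) u x - u x‖ ≤ C / r := by
  refine ⟨∫ z, ‖z‖ * ‖bumpKernel (0 : E) 1 one_pos z‖, fun r hr u hu x => ?_⟩
  have hK : Integrable (bumpKernel (0 : E) r hr) := SchwartzMap.integrable _
  have h1 : ∫ z, bumpKernel (0 : E) r hr z = 1 := by
    have h2 : 𝓕 (bumpKernel (0 : E) r hr) 0 = 1 := by
      rw [fourier_bumpKernel, schwartzBump_eq_one hr (by simpa using hr.le)]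
    rw [SchwartzMap.fourier_coe, Real.fourier_eq'] at h2
    simpa using h2
  have h2 : kernelOp (bumpKernel 0 r hr) u x - u x =
      ∫ z, bumpKernel 0 r hr z * (u (x + z) - u x) := by
    simp only [mul_sub]
    rw [integral_sub (integrable_mul_boundedContinuous hK u x) (hK.mul_const _),
      integral_mul_const, h1, one_mul, kernelOp_apply]
  have h3 : (∫ z, ‖z‖ * ‖bumpKernel (0 : E) 1 one_pos z‖) / r =
      ∫ z, ‖z‖ * ‖bumpKernel (0 : E) r hr z‖ := by
    have := Measure.integral_comp_smul (volume : Measure E)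
      (fun z => ‖z‖ * ‖bumpKernel (0 : E) 1 one_pos z‖) r
    rw [abs_of_pos (by positivity), smul_eq_mul, eq_comm, inv_mul_eq_iff_eq_mul₀ (by positivity),
      ← integral_const_mul] at this
    rw [this, div_eq_inv_mul, ← integral_const_mul]
    refine integral_congr_ae (Eventually.of_forall fun z => ?_)
    simp only [bumpKernel_apply (0 : E) hr, norm_mul, norm_smul, Complex.norm_real, Real.norm_eq_abs,
      abs_of_pos hr]
    rw [norm_exp_two_pi_inner, abs_of_pos (by positivity)]
    field_simp
  rw [h2, h3]
  refine norm_integral_le_of_norm_le ?_ (Eventually.of_forall fun z => ?_)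
  · simpa using (bumpKernel (0 : E) r hr).integrable_pow_mul volume 1
  · rw [norm_mul, mul_comm]
    gcongr
    have := hu.dist_le_mul (x + z) x
    simpa [dist_eq_norm] using this

/-- Quantitative deconvolution: if the characteristic function of `ξ` vanishes nowhere, the
bounded-Lipschitz distance of two probability measures is controlled by that of their
convolutions with `ξ`, uniformly over all pairs of measures. -/
theorem exists_abs_integral_sub_le_of_charFun_ne_zero {ξ : Measure E} [IsProbabilityMeasure ξ]
    (hξ : ∀ t : E, charFun ξ t ≠ 0) {ε : ℝ} (hε : 0 < ε) :
    ∃ M : ℝ, 0 < M ∧ ∀ (σ σ' : Measure E) [IsProbabilityMeasure σ] [IsProbabilityMeasure σ']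
      (D : ℝ), (∀ f ∈ LipBall E,
        |(∫ x, ∫ z, f (x + z) ∂ξ ∂σ) - ∫ x, ∫ z, f (x + z) ∂ξ ∂σ'| ≤ D) →
      ∀ f ∈ LipBall E, |(∫ x, f x ∂σ) - ∫ x, f x ∂σ'| ≤ ε + M * D := by
  obtain ⟨C, hC⟩ := exists_norm_kernelOp_bumpKernel_sub_le (E := E)
  obtain ⟨r, hr, hCr⟩ : ∃ r : ℝ, 0 < r ∧ C / r ≤ ε / 2 := by
    refine ⟨max 1 (2 * C / ε), by positivity, ?_⟩
    rw [div_le_iff₀ (by positivity)]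
    calc C = ε / 2 * (2 * C / ε) := by field_simp
      _ ≤ _ := by gcongr; exact le_max_right _ _
  obtain ⟨G, hG, hAG⟩ := avgFactor_kernelOp hξ (bumpKernel (0 : E) r hr)
    (isCompact_closedBall (0 : E) (2 * r)) (fun t ht => by
      rw [fourier_bumpKernel] at ht
      by_contra h
      rw [Metric.mem_closedBall, not_le] at h
      exact ht (schwartzBump_eq_zero hr h.le))
  -- The added `1` keeps the normalising constant positive even if `G` vanishes.
  have hM : 0 < ‖G‖ + 1 := by positivity
  refine ⟨‖G‖ + 1, hM, fun σ σ' _ _ D hD f hf => ?_⟩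
  have hfc : Continuous f := hf.2.continuous
  let u : E →ᵇ ℂ := BoundedContinuousFunction.ofNormedAddCommGroup (fun x => (f x : ℂ))
    (by fun_prop) 1 (fun x => by simpa using hf.1 x)
  have hu1 : ‖u‖ ≤ 1 := BoundedContinuousFunction.norm_ofNormedAddCommGroup_le _ zero_le_one _
  have hulip : LipschitzWith 1 u := by
    refine LipschitzWith.of_dist_le_mul fun x y => ?_
    have := hf.2.dist_le_mul x y
    simpa [u, Complex.dist_eq, Real.dist_eq, ← Complex.ofReal_sub] using this
  -- Since `G` commutes with translations, an increment of `G u` is a value of `G` applied to an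
  -- increment of `u`, which is small in sup norm.
  have hglip : ∀ x y, ‖G u x - G u y‖ ≤ ‖G‖ * dist x y := by
    intro x y
    have h1 : G u x - G u y = G (shiftOp (x - y) u - u) y := by
      have h2 : G (shiftOp (x - y) u) = shiftOp (x - y) (G u) :=
        congrArg (fun S => S u) (hG (x - y)).eq
      rw [map_sub, h2]
      simp [shiftOp_apply]
    rw [h1]
    calc ‖G (shiftOp (x - y) u - u) y‖ ≤ ‖G (shiftOp (x - y) u - u)‖ :=
          BoundedContinuousFunction.norm_coe_le_norm _ _
      _ ≤ ‖G‖ * ‖shiftOp (x - y) u - u‖ := G.le_opNorm _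
      _ ≤ ‖G‖ * dist x y := by
          gcongr
          refine (BoundedContinuousFunction.norm_le dist_nonneg).2 fun w => ?_
          have := hulip.dist_le_mul (w + (x - y)) w
          simpa [shiftOp_apply, dist_eq_norm] using this
  have hgbd : ∀ x, ‖G u x‖ ≤ ‖G‖ := fun x => by
    calc ‖G u x‖ ≤ ‖G u‖ := BoundedContinuousFunction.norm_coe_le_norm _ _
      _ ≤ ‖G‖ * ‖u‖ := G.le_opNorm _
      _ ≤ ‖G‖ * 1 := by gcongr
      _ = _ := mul_one _
  let g : E → ℝ := fun x => (‖G‖ + 1)⁻¹ * (G u x).re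
  have hg : g ∈ LipBall E := by
    refine ⟨fun x => ?_, LipschitzWith.of_dist_le_mul fun x y => ?_⟩
    · simp only [g]
      rw [abs_mul, abs_of_pos (inv_pos.2 hM), inv_mul_le_iff₀ hM, mul_one]
      exact (Complex.abs_re_le_norm _).trans ((hgbd x).trans (by linarith))
    · simp only [g]
      rw [Real.dist_eq, ← mul_sub, abs_mul, abs_of_pos (inv_pos.2 hM), inv_mul_le_iff₀ hM,
        ← Complex.sub_re, NNReal.coe_one, one_mul]
      refine (Complex.abs_re_le_norm _).trans ((hglip x y).trans ?_)
      gcongr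
      linarith
  have hint : ∀ (m : Measure E) [IsProbabilityMeasure m] (v : E →ᵇ ℂ), Integrable v m :=
    fun m _ v => v.integrable m
  have happrox : ∀ (m : Measure E) [IsProbabilityMeasure m],
      |(∫ x, f x ∂m) - (‖G‖ + 1) * ∫ x, ∫ z, g (x + z) ∂ξ ∂m| ≤ ε / 2 := by
    intro m _
    have h1 : (‖G‖ + 1) * ∫ x, ∫ z, g (x + z) ∂ξ ∂m =
        ∫ x, (kernelOp (bumpKernel 0 r hr) u x).re ∂m := by
      rw [hAG, ← integral_const_mul]
      refine integral_congr_ae (Eventually.of_forall fun x => ?_)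
      simp only [mul_apply_eq_comp, avg_apply, g]
      rw [integral_const_mul, mul_inv_cancel_left₀ hM.ne']
      have : Integrable (fun z => G u (x + z)) ξ :=
        Integrable.of_bound (C := ‖G u‖) (by fun_prop)
          (Eventually.of_forall fun y => (G u).norm_coe_le_norm _)
      exact integral_re this
    have h2 : Integrable f m := Integrable.of_bound (C := 1) hfc.aestronglyMeasurable
      (Eventually.of_forall fun x => by simpa using hf.1 x)
    have h5 : Integrable (fun x => (kernelOp (bumpKernel 0 r hr) u x).re) m := (hint m _).re
    rw [h1, ← integral_sub h2 h5, ← Real.norm_eq_abs]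
    have := norm_integral_le_of_norm_le_const (μ := m) (C := ε / 2)
      (f := fun x => f x - (kernelOp (bumpKernel 0 r hr) u x).re)
      (Eventually.of_forall fun x => by
        have h3 := (hC r hr u hulip x).trans hCr
        have h4 := (Complex.abs_re_le_norm _).trans h3
        rw [Complex.sub_re, abs_sub_comm] at h4
        exact h4)
    simpa using this
  have h1 := happrox σ
  have h2 := happrox σ'
  have h3 := mul_le_mul_of_nonneg_left (hD g hg) hM.le
  rw [← abs_of_pos hM, ← abs_mul, abs_of_pos hM, mul_sub] at h3
  rw [abs_le] at *
  constructor <;> linarith [h1.1, h1.2, h2.1, h2.2, h3.1, h3.2]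

end Deconvolution

/-! ### Passing from the law of `h(X)` to the law of `X` -/

section UniformlyContinuousInverse

theorem integrable_of_mem_lipBall {E : Type*} [PseudoMetricSpace E] [MeasurableSpace E]
    [OpensMeasurableSpace E] {f : E → ℝ} (hf : f ∈ LipBall E) (m : Measure E)
    [IsFiniteMeasure m] : Integrable f m :=
  Integrable.of_bound (C := 1) hf.2.continuous.measurable.aestronglyMeasurable
    (Eventually.of_forall hf.1)

/-- Regularization by infimal convolution: bounded-Lipschitz functions composed with a uniformly
continuous inverse of `h` are uniformly close to functions with a common Lipschitz constant. -/
theorem exists_smul_mem_lipBall_comp_approx {X E : Type*} [PseudoMetricSpace X]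
    [PseudoMetricSpace E] {h : X → E} {g : E → X} (hgh : Function.LeftInverse g h)
    (hg : UniformContinuousOn g (Set.range h)) {ε : ℝ} (hε : 0 < ε) :
    ∃ L : ℝ, 1 ≤ L ∧ ∀ f ∈ LipBall X, ∃ F ∈ LipBall E, ∀ x, |f x - L * F (h x)| ≤ ε := by
  obtain ⟨δ, hδ, hgδ⟩ := Metric.uniformContinuousOn_iff.1 hg ε hε
  -- With this slope, a point at distance at least `δ` pays a penalty of at least `2`, the largest
  -- possible oscillation of `f`. Only closer points compete in the infimum, and there `f` varies by
  -- less than `ε`.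
  let L : ℝ := max 1 (2 / δ)
  have hL1 : 1 ≤ L := le_max_left _ _
  have hL0 : 0 < L := by linarith
  refine ⟨L, hL1, fun f hf => ?_⟩
  rcases isEmpty_or_nonempty X with hX | hX
  · exact ⟨fun _ => 0, ⟨by simp, LipschitzWith.const' 0⟩, fun x => hX.elim x⟩
  let I : E → ℝ := fun w => ⨅ y, (f y + L * dist w (h y))
  have hfl : ∀ y, -1 ≤ f y := fun y => (abs_le.1 (hf.1 y)).1
  have hfu : ∀ y, f y ≤ 1 := fun y => (abs_le.1 (hf.1 y)).2
  have hlb : ∀ w y, -1 ≤ f y + L * dist w (h y) := fun w y => by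
    have : 0 ≤ L * dist w (h y) := by positivity
    linarith [hfl y]
  have hbdd : ∀ w, BddBelow (Set.range fun y => f y + L * dist w (h y)) := fun w =>
    ⟨-1, by rintro _ ⟨y, rfl⟩; exact hlb w y⟩
  have hIlip : LipschitzWith L.toNNReal I := by
    refine LipschitzWith.of_le_add_mul _ fun w w' => ?_
    rw [Real.coe_toNNReal _ hL0.le, ← sub_le_iff_le_add]
    refine le_ciInf fun y => ?_
    have h1 : I w ≤ f y + L * dist w (h y) := ciInf_le (hbdd w) y
    have h2 : L * dist w (h y) ≤ L * dist w w' + L * dist w' (h y) := by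
      rw [← mul_add]
      gcongr
      exact dist_triangle _ _ _
    linarith
  have hIl : ∀ w, -1 ≤ I w := fun w => le_ciInf (hlb w)
  -- Far from the range of `h` the infimum can be large; truncating at `1` restores the bound and
  -- leaves the values on the range unchanged.
  let F : E → ℝ := fun w => L⁻¹ * min (I w) 1
  have hLF : ∀ w, L * F w = min (I w) 1 := fun w => mul_inv_cancel_left₀ hL0.ne' _
  have hmin : ∀ w, |min (I w) 1| ≤ 1 := fun w =>
    abs_le.2 ⟨le_min (hIl w) (by norm_num), min_le_right _ _⟩
  refine ⟨F, ⟨fun w => ?_, LipschitzWith.of_dist_le_mul fun w w' => ?_⟩, fun x => ?_⟩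
  · simp only [F]
    rw [abs_mul, abs_of_pos (inv_pos.2 hL0), inv_mul_le_iff₀ hL0]
    linarith [hmin w]
  · simp only [F]
    rw [Real.dist_eq, ← mul_sub, abs_mul, abs_of_pos (inv_pos.2 hL0), inv_mul_le_iff₀ hL0,
      NNReal.coe_one, one_mul]
    have h1 := (hIlip.min_const 1).dist_le_mul w w'
    rwa [Real.coe_toNNReal _ hL0.le, Real.dist_eq] at h1
  · rw [hLF]
    have h1 : I (h x) ≤ f x := by
      have := ciInf_le (hbdd (h x)) x
      simpa using this
    have h2 : f x - ε ≤ I (h x) := by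
      refine le_ciInf fun y => ?_
      by_cases hd : dist (h x) (h y) < δ
      · have h3 := hgδ _ ⟨x, rfl⟩ _ ⟨y, rfl⟩ hd
        rw [hgh, hgh] at h3
        have h4 := hf.2.dist_le_mul x y
        rw [NNReal.coe_one, one_mul, Real.dist_eq] at h4
        have h5 : 0 ≤ L * dist (h x) (h y) := by positivity
        linarith [le_abs_self (f x - f y)]
      · rw [not_lt] at hd
        have h3 : 2 ≤ L * dist (h x) (h y) := by
          calc (2 : ℝ) = 2 / δ * δ := by field_simp
            _ ≤ L * dist (h x) (h y) := by gcongr; exact le_max_right _ _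
        linarith [hfl y, hfu x]
    rw [min_eq_left (h1.trans (hfu x)), abs_le]
    constructor <;> linarith

theorem exists_abs_integral_sub_le_of_uniformContinuousOn_inverse {E : Type*}
    [NormedAddCommGroup E] [InnerProductSpace ℝ E] [FiniteDimensional ℝ E] [MeasurableSpace E]
    [BorelSpace E] {ξ : Measure E} [IsProbabilityMeasure ξ] (hξ : ∀ t : E, charFun ξ t ≠ 0)
    {h g : E → E} (hmeas : Measurable h) (hgh : Function.LeftInverse g h)
    (hg : UniformContinuousOn g (Set.range h)) {ε : ℝ} (hε : 0 < ε) :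
    ∃ M : ℝ, 0 < M ∧ ∀ (ρ ρ' : Measure E) [IsProbabilityMeasure ρ] [IsProbabilityMeasure ρ']
      (D : ℝ), (∀ f ∈ LipBall E,
        |(∫ x, ∫ z, f (h x + z) ∂ξ ∂ρ) - ∫ x, ∫ z, f (h x + z) ∂ξ ∂ρ'| ≤ D) →
      ∀ f ∈ LipBall E, |(∫ x, f x ∂ρ) - ∫ x, f x ∂ρ'| ≤ ε + M * D := by
  obtain ⟨L, hL1, hL⟩ := exists_smul_mem_lipBall_comp_approx hgh hg
    (show (0 : ℝ) < ε / 4 by positivity)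
  have hL0 : 0 < L := by linarith
  -- Multiplication by `L` turns this error into `ε / 2`; approximating `f` under the two measures
  -- costs `ε / 4` each.
  obtain ⟨M, hM, hdec⟩ := exists_abs_integral_sub_le_of_charFun_ne_zero hξ
    (show 0 < ε / 2 / L by positivity)
  refine ⟨L * M, by positivity, fun ρ ρ' _ _ D hD f hf => ?_⟩
  obtain ⟨F, hF, hFf⟩ := hL f hf
  have hpρ := Measure.isProbabilityMeasure_map (μ := ρ) hmeas.aemeasurable
  have hpρ' := Measure.isProbabilityMeasure_map (μ := ρ') hmeas.aemeasurable
  have hmap : ∀ (m : Measure E) (φ : E → ℝ), φ ∈ LipBall E →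
      ∫ x, ∫ z, φ (x + z) ∂ξ ∂(m.map h) = ∫ x, ∫ z, φ (h x + z) ∂ξ ∂m := by
    intro m φ hφ
    rw [integral_map hmeas.aemeasurable]
    have h1 : StronglyMeasurable (Function.uncurry fun x z : E => φ (x + z)) :=
      (hφ.2.continuous.comp continuous_add).stronglyMeasurable
    exact h1.integral_prod_right.aestronglyMeasurable
  have h1 := hdec (ρ.map h) (ρ'.map h) D (fun φ hφ => by
    rw [hmap ρ φ hφ, hmap ρ' φ hφ]; exact hD φ hφ) F hF
  have hFm : StronglyMeasurable F := hF.2.continuous.stronglyMeasurable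
  rw [integral_map hmeas.aemeasurable hFm.aestronglyMeasurable,
    integral_map hmeas.aemeasurable hFm.aestronglyMeasurable] at h1
  have happrox : ∀ (m : Measure E) [IsProbabilityMeasure m],
      |(∫ x, f x ∂m) - L * ∫ x, F (h x) ∂m| ≤ ε / 4 := by
    intro m _
    have h2 : Integrable (fun x => F (h x)) m := Integrable.of_bound (C := 1)
      (hFm.comp_measurable hmeas).aestronglyMeasurable (Eventually.of_forall fun x => hF.1 _)
    rw [← integral_const_mul, ← integral_sub (integrable_of_mem_lipBall hf m) (h2.const_mul L)]
    have := norm_integral_le_of_norm_le_const (μ := m) (C := ε / 4)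
      (f := fun x => f x - L * F (h x)) (Eventually.of_forall hFf)
    simpa using this
  have h2 := happrox ρ
  have h3 := happrox ρ'
  have h4 := mul_le_mul_of_nonneg_left h1 hL0.le
  rw [← abs_of_pos hL0, ← abs_mul, abs_of_pos hL0, mul_sub] at h4
  have h5 : L * (ε / 2 / L + M * D) = ε / 2 + L * M * D := by field_simp
  rw [h5] at h4
  rw [abs_le] at *
  constructor <;> linarith [h2.1, h2.2, h3.1, h3.2, h4.1, h4.2]

end UniformlyContinuousInverse

/-! ### Reduction to countably many test functions -/

section CountableDense

/-- Evaluation on a dense sequence induces a second countable topology on the ball, and the common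
Lipschitz bound extends convergence on that sequence to every point. Pointwise convergence suffices,
by dominated convergence. -/
theorem exists_seq_dense_lipBall (E : Type*) [PseudoMetricSpace E]
    [TopologicalSpace.SeparableSpace E] [Nonempty E] :
    ∃ c : ℕ → E → ℝ, (∀ k, c k ∈ LipBall E) ∧ ∀ f ∈ LipBall E, ∃ s : ℕ → ℕ,
      ∀ x, Tendsto (fun j => c (s j) x) atTop (𝓝 (f x)) := by
  let d : ℕ → E := TopologicalSpace.denseSeq E
  let J : LipBall E → (ℕ → ℝ) := fun f k => (f : E → ℝ) (d k)
  let _ : TopologicalSpace (LipBall E) := TopologicalSpace.induced J inferInstance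
  have : SecondCountableTopology (LipBall E) := TopologicalSpace.secondCountableTopology_induced _ _ J
  have : Nonempty (LipBall E) := ⟨⟨fun _ => 0, by simp, LipschitzWith.const' 0⟩⟩
  let c : ℕ → LipBall E := TopologicalSpace.denseSeq (LipBall E)
  refine ⟨fun k => c k, fun k => (c k).2, fun f hf => ?_⟩
  obtain ⟨u, hu, hlim⟩ := mem_closure_iff_seq_limit.1
    ((TopologicalSpace.denseRange_denseSeq (LipBall E)) ⟨f, hf⟩)
  choose s hs using hu
  refine ⟨s, fun x => ?_⟩
  have h1 : ∀ k, Tendsto (fun j => (c (s j) : E → ℝ) (d k)) atTop (𝓝 (f (d k))) := by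
    intro k
    have h2 : Continuous J := continuous_induced_dom
    have h3 := ((continuous_apply k).comp h2).tendsto ⟨f, hf⟩ |>.comp hlim
    refine h3.congr fun j => ?_
    simp only [Function.comp_apply, ← hs j]
    rfl
  rw [Metric.tendsto_atTop]
  intro ε hε
  obtain ⟨k, hk⟩ := (TopologicalSpace.denseRange_denseSeq E).exists_dist_lt x
    (show 0 < ε / 3 by positivity)
  obtain ⟨N, hN⟩ := Metric.tendsto_atTop.1 (h1 k) (ε / 3) (by positivity)
  refine ⟨N, fun j hj => ?_⟩
  have h2 := (c (s j)).2.2.dist_le_mul x (d k)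
  have h3 := hf.2.dist_le_mul x (d k)
  have h4 := hN j hj
  rw [NNReal.coe_one, one_mul] at h2 h3
  have hk' : dist x (d k) < ε / 3 := hk
  calc dist ((c (s j) : E → ℝ) x) (f x)
      ≤ dist ((c (s j) : E → ℝ) x) ((c (s j) : E → ℝ) (d k)) +
        dist ((c (s j) : E → ℝ) (d k)) (f (d k)) + dist (f (d k)) (f x) :=
        dist_triangle4 _ _ _ _
    _ < ε := by
        rw [dist_comm (f (d k))]
        linarith

theorem abs_integral_integral_sub_le_of_dense {E : Type*} [NormedAddCommGroup E]
    [MeasurableSpace E] [BorelSpace E] [SecondCountableTopology E] {c : ℕ → E → ℝ}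
    (hc : ∀ k, c k ∈ LipBall E) {h : E → E} (hmeas : Measurable h) {ξ ρ ρ' : Measure E}
    [IsProbabilityMeasure ξ] [IsProbabilityMeasure ρ] [IsProbabilityMeasure ρ'] {D : ℝ}
    (hD : ∀ k, |(∫ x, ∫ z, c k (h x + z) ∂ξ ∂ρ) - ∫ x, ∫ z, c k (h x + z) ∂ξ ∂ρ'| ≤ D)
    {f : E → ℝ} {s : ℕ → ℕ} (hs : ∀ x, Tendsto (fun j => c (s j) x) atTop (𝓝 (f x))) :
    |(∫ x, ∫ z, f (h x + z) ∂ξ ∂ρ) - ∫ x, ∫ z, f (h x + z) ∂ξ ∂ρ'| ≤ D := by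
  have hm : ∀ k, StronglyMeasurable (Function.uncurry fun x z : E => c k (h x + z)) := fun k =>
    (hc k).2.continuous.stronglyMeasurable.comp_measurable
      ((hmeas.comp measurable_fst).add measurable_snd)
  have hlim : ∀ (m : Measure E) [IsProbabilityMeasure m],
      Tendsto (fun j => ∫ x, ∫ z, c (s j) (h x + z) ∂ξ ∂m) atTop
        (𝓝 (∫ x, ∫ z, f (h x + z) ∂ξ ∂m)) := by
    intro m _
    refine tendsto_integral_of_dominated_convergence (fun _ => 1)
      (fun j => (hm _).integral_prod_right.aestronglyMeasurable) (integrable_const _)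
      (fun j => Eventually.of_forall fun x => ?_) (Eventually.of_forall fun x => ?_)
    · have := norm_integral_le_of_norm_le_const (μ := ξ) (C := 1)
        (f := fun z => c (s j) (h x + z)) (Eventually.of_forall fun z => (hc _).1 _)
      simpa using this
    · exact tendsto_integral_of_dominated_convergence (fun _ => 1)
        (fun j => ((hc _).2.continuous.comp (continuous_const_add _)).aestronglyMeasurable)
        (integrable_const _) (fun j => Eventually.of_forall fun z => (hc _).1 _)
        (Eventually.of_forall fun z => hs _)
  exact le_of_tendsto ((hlim ρ).sub (hlim ρ')).abs (Eventually.of_forall fun j => hD _)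

end CountableDense

/-! ### Merging of opinions -/

section Merging

variable {Ω : Type*} {m0 : MeasurableSpace Ω}

/-- Conditional version of Lévy's upward theorem: the conditional `L¹` distance of `g` to its
conditional expectation tends to zero almost surely. -/
theorem tendsto_ae_condExp_abs_sub_condExp {μ : Measure Ω} [IsFiniteMeasure μ]
    {ℱ : Filtration ℕ m0} (hℱ : ⨆ n, ℱ n = m0) {g : Ω → ℝ} (hg : Integrable g μ)
    (hgm : StronglyMeasurable g) :
    ∀ᵐ x ∂μ, Tendsto (fun n => (μ[(abs (g - μ[g | ℱ n])) | ℱ n]) x) atTop (𝓝 0) := by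
  have hgm' : StronglyMeasurable[⨆ n, ℱ n] g := by rwa [hℱ]
  have hcond : ∀ k, StronglyMeasurable (μ[g | ℱ k]) := fun k =>
    stronglyMeasurable_condExp.mono (ℱ.le k)
  have hint : ∀ k, Integrable (abs (g - μ[g | ℱ k])) μ := fun k => (hg.sub integrable_condExp).abs
  have hmeas : ∀ k, StronglyMeasurable[⨆ n, ℱ n] (abs (g - μ[g | ℱ k])) := fun k => by
    rw [hℱ]
    exact (hgm.sub (hcond k)).norm
  have h1 : ∀ᵐ x ∂μ, ∀ k, Tendsto (fun n => (μ[(abs (g - μ[g | ℱ k])) | ℱ n]) x) atTop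
      (𝓝 ((abs (g - μ[g | ℱ k])) x)) :=
    ae_all_iff.2 fun k => (hint k).tendsto_ae_condExp (hmeas k)
  have h2 := hg.tendsto_ae_condExp hgm'
  -- Freezing the inner index at `k` makes Lévy's theorem applicable. The factor `2` comes from `|g
  -- - E_n g| ≤ a + E_n a` with `a = |g - E_k g|`, conditioned once more on `ℱ n`.
  have h3 : ∀ᵐ x ∂μ, ∀ k n, k ≤ n →
      (μ[(abs (g - μ[g | ℱ n])) | ℱ n]) x ≤ 2 * (μ[(abs (g - μ[g | ℱ k])) | ℱ n]) x := by
    refine ae_all_iff.2 fun k => ae_all_iff.2 fun n => ?_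
    by_cases hkn : k ≤ n
    swap
    · exact Eventually.of_forall fun x h => absurd h hkn
    set a := (abs (g - μ[g | ℱ k])) with ha
    have e1 : μ[g - μ[g | ℱ k] | ℱ n] =ᵐ[μ] μ[g | ℱ n] - μ[g | ℱ k] := by
      refine (condExp_sub hg integrable_condExp _).trans ?_
      rw [condExp_of_stronglyMeasurable (ℱ.le n)
        (stronglyMeasurable_condExp.mono (ℱ.mono hkn)) integrable_condExp]
    have e2 : (abs (g - μ[g | ℱ n])) ≤ᵐ[μ] a + μ[a | ℱ n] := by
      filter_upwards [e1, abs_condExp_ae_le_condExp_abs (μ := μ) (m := ℱ n)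
        (g - μ[g | ℱ k])] with x hx1 hx2
      rw [Pi.abs_apply, hx1] at hx2
      simp only [ha, Pi.abs_apply, Pi.sub_apply, Pi.add_apply] at hx2 ⊢
      calc |g x - (μ[g | ℱ n]) x|
          = |(g x - (μ[g | ℱ k]) x) - ((μ[g | ℱ n]) x - (μ[g | ℱ k]) x)| := by
            congr 1; ring
        _ ≤ |g x - (μ[g | ℱ k]) x| + |(μ[g | ℱ n]) x - (μ[g | ℱ k]) x| := abs_sub _ _
        _ ≤ _ := by gcongr
    have e3 := condExp_mono (m := ℱ n) (hint n) ((hint k).add integrable_condExp) e2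
    have e4 : μ[a + μ[a | ℱ n] | ℱ n] =ᵐ[μ] μ[a | ℱ n] + μ[a | ℱ n] := by
      refine (condExp_add (hint k) integrable_condExp _).trans ?_
      rw [condExp_of_stronglyMeasurable (ℱ.le n) (f := μ[a | ℱ n]) stronglyMeasurable_condExp
        integrable_condExp]
    filter_upwards [e3, e4] with x hx3 hx4 _
    rw [hx4, Pi.add_apply] at hx3
    linarith
  have h4 : ∀ᵐ x ∂μ, ∀ n, 0 ≤ (μ[(abs (g - μ[g | ℱ n])) | ℱ n]) x :=
    ae_all_iff.2 fun n => condExp_nonneg (Eventually.of_forall fun x => abs_nonneg _)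
  filter_upwards [h1, h2, h3, h4] with x hx1 hx2 hx3 hx4
  rw [Metric.tendsto_atTop]
  intro ε hε
  obtain ⟨k, hk⟩ := (Metric.tendsto_atTop.1 hx2 (ε / 2) (by positivity))
  have hk' : (abs (g - μ[g | ℱ k])) x < ε / 2 := by
    have := hk k le_rfl
    rwa [dist_comm, Real.dist_eq] at this
  obtain ⟨N, hN⟩ := eventually_atTop.1 ((hx1 k).eventually (gt_mem_nhds hk'))
  refine ⟨max N k, fun n hn => ?_⟩
  rw [Real.dist_eq, sub_zero, abs_of_nonneg (hx4 n)]
  have := hx3 k n ((le_max_right _ _).trans hn)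
  have := hN n ((le_max_left _ _).trans hn)
  linarith

/-- Bayes-type estimate: versions of conditional expectations of `f` under two mutually comparable
laws differ, after multiplication by the conditional density, by at most the conditional `L¹`
distance of the density to its conditional expectation. -/
theorem abs_sub_mul_condExp_rnDeriv_le {μ ν : Measure Ω} [IsProbabilityMeasure μ]
    [IsProbabilityMeasure ν] (hac : μ ≪ ν) {m : MeasurableSpace Ω} (hm : m ≤ m0)
    {f F F' : Ω → ℝ} (hf : Measurable[m0] f) (hf1 : ∀ x, |f x| ≤ 1)
    (hFm : StronglyMeasurable[m] F) (hF1 : ∀ x, |F x| ≤ 1)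
    (hF'm : StronglyMeasurable[m] F') (hF'1 : ∀ x, |F' x| ≤ 1)
    (hF : ∀ A, MeasurableSet[m] A → ∫ x in A, F x ∂μ = ∫ x in A, f x ∂μ)
    (hF' : ∀ A, MeasurableSet[m] A → ∫ x in A, F' x ∂ν = ∫ x in A, f x ∂ν) :
    ∀ᵐ x ∂ν, |F x - F' x| * (ν[fun x => (μ.rnDeriv ν x).toReal | m]) x ≤
      (ν[abs ((fun x => (μ.rnDeriv ν x).toReal) - ν[fun x => (μ.rnDeriv ν x).toReal | m]) | m]) x := by
  set Λ : Ω → ℝ := fun x => (μ.rnDeriv ν x).toReal with hΛ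
  have hΛi : Integrable Λ ν := Measure.integrable_toReal_rnDeriv
  have hmulint : ∀ (a b : Ω → ℝ), StronglyMeasurable[m0] a → (∀ x, |a x| ≤ 1) → Integrable b ν →
      Integrable (a * b) ν := fun a b ha ha1 hb =>
    hb.bdd_mul (c := 1) ha.aestronglyMeasurable (Eventually.of_forall ha1)
  have hfs := hf.stronglyMeasurable
  have hFs := hFm.mono hm
  have hF's := hF'm.mono hm
  have hfi : Integrable f ν := Integrable.of_bound (C := 1) hfs.aestronglyMeasurable
    (Eventually.of_forall hf1)
  -- Bayes' formula is `e1` with `e2`: `E_ν[f Λ | m] = F * E_ν[Λ | m]`. Subtracting `F' * E_ν[Λ |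
  -- m]` leaves the conditional expectation of `f * (Λ - E_ν[Λ | m])`.
  have e1 : ν[F * Λ | m] =ᵐ[ν] F * ν[Λ | m] :=
    condExp_mul_of_stronglyMeasurable_left hFm (hmulint F Λ hFs hF1 hΛi) hΛi
  have e2 : ν[F * Λ | m] =ᵐ[ν] ν[f * Λ | m] := by
    refine ae_eq_condExp_of_forall_setIntegral_eq hm (hmulint f Λ hfs hf1 hΛi)
      (fun s _ _ => integrable_condExp.integrableOn) (fun s hs _ => ?_)
      stronglyMeasurable_condExp.aestronglyMeasurable
    rw [setIntegral_condExp hm (hmulint F Λ hFs hF1 hΛi) hs]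
    have key : ∀ a : Ω → ℝ, ∫ x in s, (a * Λ) x ∂ν = ∫ x in s, a x ∂μ := fun a => by
      rw [← setIntegral_toReal_rnDeriv_mul hac (hm s hs)]
      simp [hΛ, mul_comm]
    rw [key, key, hF s hs]
  have e3 : F' =ᵐ[ν] ν[f | m] := by
    refine ae_eq_condExp_of_forall_setIntegral_eq hm hfi (fun s _ _ => ?_)
      (fun s hs _ => hF' s hs) hF'm.aestronglyMeasurable
    exact (Integrable.of_bound (C := 1) hF's.aestronglyMeasurable
      (Eventually.of_forall hF'1)).integrableOn
  have e4 : ν[f * ν[Λ | m] | m] =ᵐ[ν] ν[f | m] * ν[Λ | m] :=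
    condExp_mul_of_stronglyMeasurable_right stronglyMeasurable_condExp
      (hmulint f _ hfs hf1 integrable_condExp) hfi
  have e5 : ν[f * Λ - f * ν[Λ | m] | m] =ᵐ[ν] ν[f * Λ | m] - ν[f * ν[Λ | m] | m] :=
    condExp_sub (hmulint f Λ hfs hf1 hΛi) (hmulint f _ hfs hf1 integrable_condExp) _
  have e6 := abs_condExp_ae_le_condExp_abs (μ := ν) (m := m) (f * Λ - f * ν[Λ | m])
  have e7 : ν[(abs (f * Λ - f * ν[Λ | m])) | m] ≤ᵐ[ν] ν[(abs (Λ - ν[Λ | m])) | m] := by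
    refine condExp_mono
      ((hmulint f Λ hfs hf1 hΛi).sub (hmulint f _ hfs hf1 integrable_condExp)).abs
      (hΛi.sub integrable_condExp).abs (Eventually.of_forall fun x => ?_)
    simp only [Pi.abs_apply, Pi.sub_apply, Pi.mul_apply, ← mul_sub, abs_mul]
    exact mul_le_of_le_one_left (abs_nonneg _) (hf1 x)
  have e8 : ∀ᵐ x ∂ν, 0 ≤ (ν[Λ | m]) x :=
    condExp_nonneg (Eventually.of_forall fun x => ENNReal.toReal_nonneg)
  filter_upwards [e1, e2, e3, e4, e5, e6, e7, e8] with x h1 h2 h3 h4 h5 h6 h7 h8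
  refine le_trans (le_of_eq ?_) (h6.trans h7)
  rw [Pi.abs_apply, h5, Pi.sub_apply, h4, ← h2, h1, Pi.mul_apply, Pi.mul_apply, ← h3, ← sub_mul,
    abs_mul, abs_of_nonneg h8]

/-- Merging of opinions: versions of the conditional expectations of a countable family of
functions bounded by `1`, under `μ` and under `ν` with `μ ≪ ν`, merge uniformly over the family,
almost surely under `μ`. -/
theorem ae_exists_tendsto_zero_abs_sub_le {ι : Type*} [Countable ι] {μ ν : Measure Ω}
    [IsProbabilityMeasure μ] [IsProbabilityMeasure ν] (hac : μ ≪ ν) {ℱ : Filtration ℕ m0}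
    (hℱ : ⨆ n, ℱ n = m0) {f F F' : ℕ → ι → Ω → ℝ}
    (hf : ∀ n k, Measurable (f n k)) (hf1 : ∀ n k x, |f n k x| ≤ 1)
    (hFm : ∀ n k, StronglyMeasurable[ℱ n] (F n k)) (hF1 : ∀ n k x, |F n k x| ≤ 1)
    (hF'm : ∀ n k, StronglyMeasurable[ℱ n] (F' n k)) (hF'1 : ∀ n k x, |F' n k x| ≤ 1)
    (hF : ∀ n k A, MeasurableSet[ℱ n] A → ∫ x in A, F n k x ∂μ = ∫ x in A, f n k x ∂μ)
    (hF' : ∀ n k A, MeasurableSet[ℱ n] A → ∫ x in A, F' n k x ∂ν = ∫ x in A, f n k x ∂ν) :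
    ∀ᵐ x ∂μ, ∃ D : ℕ → ℝ, Tendsto D atTop (𝓝 0) ∧
      ∀ᶠ n in atTop, ∀ k, |F n k x - F' n k x| ≤ D n := by
  set Λ : Ω → ℝ := fun x => (μ.rnDeriv ν x).toReal with hΛ
  have hΛi : Integrable Λ ν := Measure.integrable_toReal_rnDeriv
  have hΛm : StronglyMeasurable Λ := (Measure.measurable_rnDeriv μ ν).ennreal_toReal.stronglyMeasurable
  have h1 : ∀ᵐ x ∂ν, ∀ n k, |F n k x - F' n k x| * (ν[Λ | ℱ n]) x ≤
      (ν[(abs (Λ - ν[Λ | ℱ n])) | ℱ n]) x :=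
    ae_all_iff.2 fun n => ae_all_iff.2 fun k => abs_sub_mul_condExp_rnDeriv_le hac (ℱ.le n)
      (hf n k) (hf1 n k) (hFm n k) (hF1 n k) (hF'm n k) (hF'1 n k) (hF n k) (hF' n k)
  have h2 := tendsto_ae_condExp_abs_sub_condExp hℱ hΛi hΛm
  have h3 : ∀ᵐ x ∂ν, Tendsto (fun n => (ν[Λ | ℱ n]) x) atTop (𝓝 (Λ x)) :=
    hΛi.tendsto_ae_condExp (by rwa [hℱ])
  have h4 : ∀ᵐ x ∂μ, 0 < Λ x := by
    filter_upwards [Measure.rnDeriv_pos hac, hac.ae_le (Measure.rnDeriv_lt_top μ ν)] with x hx hx'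
    exact ENNReal.toReal_pos hx.ne' hx'.ne
  filter_upwards [hac.ae_le h1, hac.ae_le h2, hac.ae_le h3, h4] with x hx1 hx2 hx3 hx4
  -- The bound involves only the density, so the test functions may change with `n`. Dividing is
  -- legitimate for large `n`, since the denominators converge to `Λ x > 0`.
  refine ⟨fun n => (ν[(abs (Λ - ν[Λ | ℱ n])) | ℱ n]) x / (ν[Λ | ℱ n]) x, ?_, ?_⟩
  · have := hx2.div hx3 hx4.ne'
    rwa [zero_div] at this
  · filter_upwards [hx3.eventually (lt_mem_nhds hx4)] with n hn k
    rw [le_div_iff₀ hn]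
    exact hx1 n k

end Merging

/-! ### Predictive laws of the observations -/

section HiddenMarkov

theorem iSup_piLE_nat {E : Type*} [MeasurableSpace E] :
    ⨆ n, (Filtration.piLE (X := fun _ : ℕ => E)) n = MeasurableSpace.pi := by
  refine le_antisymm (iSup_le fun n => Filtration.le _ n) ?_
  refine iSup_le fun i => le_iSup_of_le i ?_
  rw [Filtration.piLE_eq_comap_frestrictLe]
  have h : (fun y : ℕ → E => y i) =
      (fun w : Finset.Iic i → E => w ⟨i, Finset.mem_Iic.2 le_rfl⟩) ∘ Preorder.frestrictLe i := rfl
  rw [h, ← MeasurableSpace.comap_comp]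
  exact MeasurableSpace.comap_mono (measurable_pi_apply _).comap_le

variable {E : Type*} [NormedAddCommGroup E] [MeasurableSpace E] [BorelSpace E]
  [SecondCountableTopology E] {K : Kernel E E} [IsMarkovKernel K] {h : E → E} {ξ μ : Measure E}
  [IsProbabilityMeasure ξ] [IsProbabilityMeasure μ]

theorem measurable_hmmLaw_map (hmeas : Measurable h) :
    Measurable fun p : (ℕ → E) × (ℕ → E) => (p.1, fun n => h (p.1 n) + p.2 n) := by
  fun_prop

instance isProbabilityMeasure_chainLaw : IsProbabilityMeasure (chainLaw K μ) := by
  unfold chainLaw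
  infer_instance

theorem isProbabilityMeasure_hmmLaw (hmeas : Measurable h) :
    IsProbabilityMeasure (hmmLaw K h ξ μ) :=
  Measure.isProbabilityMeasure_map (measurable_hmmLaw_map hmeas).aemeasurable

omit [NormedAddCommGroup E] [BorelSpace E] [SecondCountableTopology E] in
theorem measurable_obsHistory (n : ℕ) :
    Measurable (obsHistory n : (ℕ → E) × (ℕ → E) → Finset.Iic n → E) := by
  unfold obsHistory
  fun_prop

theorem measurable_integral_add {f : E → ℝ} (hf : Measurable f) (hmeas : Measurable h) :
    Measurable fun x => ∫ z, f (h x + z) ∂ξ := by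
  have h1 : StronglyMeasurable (Function.uncurry fun x z : E => f (h x + z)) :=
    (hf.comp ((hmeas.comp measurable_fst).add measurable_snd)).stronglyMeasurable
  exact h1.integral_prod_right.measurable

omit [BorelSpace E] [SecondCountableTopology E] in
theorem abs_integral_add_le_one {f : E → ℝ} (hf1 : ∀ x, |f x| ≤ 1) (x : E) :
    |∫ z, f (x + z) ∂ξ| ≤ 1 := by
  have := norm_integral_le_of_norm_le_const (μ := ξ) (C := 1)
    (f := fun z => f (x + z)) (Eventually.of_forall fun z => hf1 _)
  simpa using this

/-- The noise at time `n + 1` is independent of the signal and of the observations up to time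
`n`, so it can be integrated out. -/
theorem integral_mul_obs_succ (hmeas : Measurable h) (n : ℕ) {φ : (Finset.Iic n → E) → ℝ}
    (hφ : Measurable φ) (hφ1 : ∀ w, |φ w| ≤ 1) {f : E → ℝ} (hf : Measurable f)
    (hf1 : ∀ x, |f x| ≤ 1) :
    ∫ ω, φ (obsHistory n ω) * f (ω.2 (n + 1)) ∂(hmmLaw K h ξ μ) =
      ∫ ω, φ (obsHistory n ω) * ∫ z, f (h (ω.1 (n + 1)) + z) ∂ξ ∂(hmmLaw K h ξ μ) := by
  have hT := measurable_hmmLaw_map (E := E) hmeas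
  have hobs := measurable_obsHistory (E := E) n
  have hG := measurable_integral_add (ξ := ξ) hf hmeas
  have hm1 : Measurable fun ω : (ℕ → E) × (ℕ → E) => φ (obsHistory n ω) * f (ω.2 (n + 1)) := by
    fun_prop
  have hm2 : Measurable fun ω : (ℕ → E) × (ℕ → E) =>
      φ (obsHistory n ω) * ∫ z, f (h (ω.1 (n + 1)) + z) ∂ξ :=
    (hφ.comp hobs).mul (hG.comp ((measurable_pi_apply _).comp measurable_fst))
  have hfub : ∀ a : (ℕ → E) × (ℕ → E) → ℝ, Measurable a → (∀ ω, |a ω| ≤ 1) →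
      ∫ ω, a ω ∂(hmmLaw K h ξ μ) = ∫ x, ∫ w, a (x, fun n => h (x n) + w n)
        ∂(Measure.infinitePi fun _ : ℕ => ξ) ∂(chainLaw K μ) := fun a ha ha1 => by
    rw [hmmLaw, integral_map hT.aemeasurable ha.aestronglyMeasurable]
    exact integral_prod _ (Integrable.of_bound (C := 1) (ha.comp hT).aestronglyMeasurable
      (Eventually.of_forall fun _ => ha1 _))
  have hmul : ∀ a b : ℝ, |a| ≤ 1 → |b| ≤ 1 → |a * b| ≤ 1 := fun a b ha hb => by
    rw [abs_mul]
    exact mul_le_one₀ ha (abs_nonneg _) hb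
  rw [hfub _ hm1 fun ω => hmul _ _ (hφ1 _) (hf1 _),
    hfub _ hm2 fun ω => hmul _ _ (hφ1 _) (abs_integral_add_le_one hf1 _)]
  -- With the signal path `x` frozen by Fubini, only the noise is random: the history involves its
  -- coordinates up to `n`, the new observation only coordinate `n + 1`.
  refine integral_congr_ae (Eventually.of_forall fun x => ?_)
  dsimp only
  rw [integral_mul_const]
  have hind : iIndepFun (fun (i : ℕ) (w : ℕ → E) => w i) (Measure.infinitePi fun _ : ℕ => ξ) :=
    iIndepFun_infinitePi (X := fun _ x => x) fun _ => measurable_id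
  have hind2 := hind.indepFun_finset (Finset.Iic n) {n + 1} (by simp)
    (fun i => measurable_pi_apply i)
  let U : (Finset.Iic n → E) → ℝ := fun w => φ fun i => h (x i) + w i
  let V : (({n + 1} : Finset ℕ) → E) → ℝ := fun w =>
    f (h (x (n + 1)) + w ⟨n + 1, Finset.mem_singleton_self _⟩)
  have hU : Measurable U := hφ.comp (by fun_prop)
  have hV : Measurable V := hf.comp (by fun_prop)
  have hind3 := hind2.comp hU hV
  have hprod := hind3.integral_fun_mul_eq_mul_integral
    (hU.comp (by fun_prop)).aestronglyMeasurable (hV.comp (by fun_prop)).aestronglyMeasurable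
  refine hprod.trans ?_
  congr 1
  have h1 : ∫ w, f (h (x (n + 1)) + w (n + 1)) ∂(Measure.infinitePi fun _ : ℕ => ξ) =
      ∫ z, f (h (x (n + 1)) + z) ∂((Measure.infinitePi fun _ : ℕ => ξ).map fun w => w (n + 1)) := by
    rw [integral_map (measurable_pi_apply (n + 1)).aemeasurable]
    exact (hf.comp (measurable_const_add _)).aestronglyMeasurable
  rw [Measure.infinitePi_map_eval (fun _ : ℕ => ξ) (n + 1)] at h1
  exact h1

theorem integral_mul_signal_succ (hmeas : Measurable h)
    {π : (n : ℕ) → Kernel (Finset.Iic n → E) E} (hπ : IsOneStepPredictor (hmmLaw K h ξ μ) π)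
    (n : ℕ) {φ : (Finset.Iic n → E) → ℝ} (hφ : Measurable φ) (hφ1 : ∀ w, |φ w| ≤ 1) {G : E → ℝ}
    (hG : Measurable G) (hG1 : ∀ x, |G x| ≤ 1) :
    ∫ ω, φ (obsHistory n ω) * G (ω.1 (n + 1)) ∂(hmmLaw K h ξ μ) =
      ∫ ω, φ (obsHistory n ω) * ∫ x, G x ∂(π n (obsHistory n ω)) ∂(hmmLaw K h ξ μ) := by
  have := hπ.isMarkovKernel n
  have := isProbabilityMeasure_hmmLaw (K := K) (ξ := ξ) (μ := μ) hmeas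
  have hobs := measurable_obsHistory (E := E) n
  have hm : Measurable fun p : (Finset.Iic n → E) × E => φ p.1 * G p.2 := by fun_prop
  have hp := Measure.isProbabilityMeasure_map (μ := hmmLaw K h ξ μ) hobs.aemeasurable
  have hGk : StronglyMeasurable fun w => ∫ x, G x ∂(π n w) :=
    hG.stronglyMeasurable.integral_kernel
  calc ∫ ω, φ (obsHistory n ω) * G (ω.1 (n + 1)) ∂(hmmLaw K h ξ μ)
      = ∫ p, φ p.1 * G p.2 ∂((hmmLaw K h ξ μ).map fun ω => (obsHistory n ω, ω.1 (n + 1))) :=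
        (integral_map (hπ.hasCondDistrib n).aemeasurable hm.aestronglyMeasurable).symm
    _ = ∫ p, φ p.1 * G p.2 ∂(((hmmLaw K h ξ μ).map (obsHistory n)) ⊗ₘ (π n)) := by
        rw [(hπ.hasCondDistrib n).map_eq]
    _ = ∫ w, φ w * ∫ x, G x ∂(π n w) ∂((hmmLaw K h ξ μ).map (obsHistory n)) := by
        rw [Measure.integral_compProd]
        · simp only [integral_const_mul]
        · refine Integrable.of_bound (C := 1) hm.aestronglyMeasurable
            (Eventually.of_forall fun p => ?_)
          rw [Real.norm_eq_abs, abs_mul]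
          exact mul_le_one₀ (hφ1 _) (abs_nonneg _) (hG1 _)
    _ = _ := integral_map hobs.aemeasurable (hφ.mul hGk.measurable).aestronglyMeasurable

/-- The predicted mean of `f (Y (n + 1))` as a function of the observation path. -/
noncomputable def predictedMean (h : E → E) (ξ : Measure E)
    (π : (n : ℕ) → Kernel (Finset.Iic n → E) E) (n : ℕ) (f : E → ℝ) (y : ℕ → E) : ℝ :=
  ∫ x, ∫ z, f (h x + z) ∂ξ ∂(π n (Preorder.frestrictLe n y))

theorem stronglyMeasurable_predictedMean (hmeas : Measurable h)
    (π : (n : ℕ) → Kernel (Finset.Iic n → E) E) (n : ℕ) {f : E → ℝ} (hf : Measurable f) :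
    StronglyMeasurable[(Filtration.piLE (X := fun _ : ℕ => E)) n]
      (predictedMean h ξ π n f) := by
  have h1 : StronglyMeasurable fun w => ∫ x, ∫ z, f (h x + z) ∂ξ ∂(π n w) :=
    (measurable_integral_add hf hmeas).stronglyMeasurable.integral_kernel
  rw [Filtration.piLE_eq_comap_frestrictLe]
  exact h1.comp_measurable (comap_measurable _)

omit [BorelSpace E] [SecondCountableTopology E] in
theorem abs_predictedMean_le_one {π : (n : ℕ) → Kernel (Finset.Iic n → E) E} (n : ℕ)
    [IsMarkovKernel (π n)] {f : E → ℝ} (hf1 : ∀ x, |f x| ≤ 1) (y : ℕ → E) :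
    |predictedMean h ξ π n f y| ≤ 1 := by
  have := norm_integral_le_of_norm_le_const (μ := π n (Preorder.frestrictLe n y)) (C := 1)
    (f := fun x => ∫ z, f (h x + z) ∂ξ)
    (Eventually.of_forall fun x => abs_integral_add_le_one hf1 _)
  simpa [predictedMean] using this

/-- Tower property: first the fresh noise is integrated out, then the signal is replaced by its
predictor. This identifies `predictedMean` as a conditional expectation on the space of observation
paths, where the two laws are comparable. -/
theorem setIntegral_predictedMean (hmeas : Measurable h)
    {π : (n : ℕ) → Kernel (Finset.Iic n → E) E} (hπ : IsOneStepPredictor (hmmLaw K h ξ μ) π)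
    (n : ℕ) {f : E → ℝ} (hf : Measurable f) (hf1 : ∀ x, |f x| ≤ 1) {A : Set (ℕ → E)}
    (hA : MeasurableSet[(Filtration.piLE (X := fun _ : ℕ => E)) n] A) :
    ∫ y in A, predictedMean h ξ π n f y ∂((hmmLaw K h ξ μ).map Prod.snd) =
      ∫ y in A, f (y (n + 1)) ∂((hmmLaw K h ξ μ).map Prod.snd) := by
  have hA' : MeasurableSet A := Filtration.le _ n _ hA
  rw [Filtration.piLE_eq_comap_frestrictLe] at hA
  obtain ⟨B, hB, rfl⟩ := hA
  let φ : (Finset.Iic n → E) → ℝ := B.indicator fun _ => 1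
  have hφ : Measurable φ := measurable_const.indicator hB
  have hφ1 : ∀ w, |φ w| ≤ 1 := fun w => by
    by_cases hw : w ∈ B <;> simp [φ, hw]
  have key : ∀ a : (ℕ → E) → ℝ, Measurable a →
      ∫ y in Preorder.frestrictLe n ⁻¹' B, a y ∂((hmmLaw K h ξ μ).map Prod.snd) =
        ∫ ω, φ (obsHistory n ω) * a ω.2 ∂(hmmLaw K h ξ μ) := by
    intro a ha
    rw [← integral_indicator hA', integral_map measurable_snd.aemeasurable
      (ha.indicator hA').aestronglyMeasurable]
    refine integral_congr_ae (Eventually.of_forall fun ω => ?_)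
    by_cases hw : obsHistory n ω ∈ B
    · have hw' : ω.2 ∈ Preorder.frestrictLe n ⁻¹' B := hw
      simp only [φ, Set.indicator_of_mem hw, Set.indicator_of_mem hw', one_mul]
    · have hw' : ω.2 ∉ Preorder.frestrictLe n ⁻¹' B := hw
      simp only [φ, Set.indicator_of_notMem hw, Set.indicator_of_notMem hw', zero_mul]
  have hpm : Measurable (predictedMean h ξ π n f) :=
    ((stronglyMeasurable_predictedMean hmeas π n hf).mono (Filtration.le _ n)).measurable
  rw [key _ hpm, key (fun y => f (y (n + 1))) (hf.comp (measurable_pi_apply _)),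
    integral_mul_obs_succ hmeas n hφ hφ1 hf hf1,
    integral_mul_signal_succ hmeas hπ n hφ hφ1 (measurable_integral_add hf hmeas)
      fun x => abs_integral_add_le_one hf1 _]
  rfl

end HiddenMarkov

/-! ### Conclusion -/

theorem blDist_le_of_forall {S : Type*} [PseudoMetricSpace S] [MeasurableSpace S]
    {ρ ρ' : Measure S} {a : ℝ}
    (ha : ∀ f ∈ LipBall S, |(∫ x, f x ∂ρ) - ∫ x, f x ∂ρ'| ≤ a) : blDist ρ ρ' ≤ a := by
  have : Nonempty (LipBall S) := ⟨⟨fun _ => 0, by simp, LipschitzWith.const' 0⟩⟩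
  exact ciSup_le fun f => ha f f.2

theorem blDist_nonneg {S : Type*} [PseudoMetricSpace S] [MeasurableSpace S]
    (ρ ρ' : Measure S) : 0 ≤ blDist ρ ρ' :=
  Real.iSup_nonneg fun _ => abs_nonneg _

theorem proposition3p11 (q : ℕ)
    (K : Kernel (EuclideanSpace ℝ (Fin q)) (EuclideanSpace ℝ (Fin q))) [IsMarkovKernel K]
    (h : EuclideanSpace ℝ (Fin q) → EuclideanSpace ℝ (Fin q)) (hmeas : Measurable h)
    (ξ : Measure (EuclideanSpace ℝ (Fin q))) [IsProbabilityMeasure ξ]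
    (hinv : ∃ g : EuclideanSpace ℝ (Fin q) → EuclideanSpace ℝ (Fin q),
      Function.LeftInverse g h ∧ UniformContinuousOn g (Set.range h))
    (hξ : ∀ t : EuclideanSpace ℝ (Fin q), charFun ξ t ≠ 0)
    (μ ν : Measure (EuclideanSpace ℝ (Fin q))) [IsProbabilityMeasure μ] [IsProbabilityMeasure ν]
    (πμ πν : (n : ℕ) → Kernel (Finset.Iic n → EuclideanSpace ℝ (Fin q)) (EuclideanSpace ℝ (Fin q)))
    (hπμ : IsOneStepPredictor (hmmLaw K h ξ μ) πμ)
    (hπν : IsOneStepPredictor (hmmLaw K h ξ ν) πν)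
    (hac : (hmmLaw K h ξ μ).map Prod.snd ≪ (hmmLaw K h ξ ν).map Prod.snd) :
    ∀ᵐ ω ∂(hmmLaw K h ξ μ),
      Tendsto (fun n => blDist (πμ n (obsHistory n ω)) (πν n (obsHistory n ω))) atTop (𝓝 0) := by
  obtain ⟨g, hgh, hg⟩ := hinv
  obtain ⟨c, hc, hdense⟩ := exists_seq_dense_lipBall (EuclideanSpace ℝ (Fin q))
  have := isProbabilityMeasure_hmmLaw (K := K) (ξ := ξ) (μ := μ) hmeas
  have := isProbabilityMeasure_hmmLaw (K := K) (ξ := ξ) (μ := ν) hmeas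
  have := Measure.isProbabilityMeasure_map (μ := hmmLaw K h ξ μ) measurable_snd.aemeasurable
  have := Measure.isProbabilityMeasure_map (μ := hmmLaw K h ξ ν) measurable_snd.aemeasurable
  have hMμ := hπμ.isMarkovKernel
  have hMν := hπν.isMarkovKernel
  have hcm : ∀ k, Measurable (c k) := fun k => (hc k).2.continuous.measurable
  have hmerge := ae_exists_tendsto_zero_abs_sub_le hac iSup_piLE_nat
    (f := fun n k y => c k (y (n + 1))) (F := fun n k => predictedMean h ξ πμ n (c k))
    (F' := fun n k => predictedMean h ξ πν n (c k))
    (fun n k => (hcm k).comp (measurable_pi_apply _)) (fun n k y => (hc k).1 _)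
    (fun n k => stronglyMeasurable_predictedMean hmeas πμ n (hcm k))
    (fun n k y => abs_predictedMean_le_one n (hc k).1 y)
    (fun n k => stronglyMeasurable_predictedMean hmeas πν n (hcm k))
    (fun n k y => abs_predictedMean_le_one n (hc k).1 y)
    (fun n k A hA => setIntegral_predictedMean hmeas hπμ n (hcm k) (hc k).1 hA)
    (fun n k A hA => setIntegral_predictedMean hmeas hπν n (hcm k) (hc k).1 hA)
  filter_upwards [ae_of_ae_map measurable_snd.aemeasurable hmerge] with ω hω
  obtain ⟨D, hD0, hD⟩ := hω
  rw [Metric.tendsto_nhds]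
  intro ε hε
  -- `M` depends on `ε` but not on `n` or on the predictors, so `M * D n` still tends to `0`.
  obtain ⟨M, hM, hobs⟩ := exists_abs_integral_sub_le_of_uniformContinuousOn_inverse hξ hmeas hgh hg
    (show (0 : ℝ) < ε / 2 by positivity)
  filter_upwards [hD, hD0.eventually (gt_mem_nhds (show (0 : ℝ) < ε / 2 / M by positivity))]
    with n hn hnM
  rw [Real.dist_eq, sub_zero, abs_of_nonneg (blDist_nonneg _ _)]
  have hle : blDist (πμ n (obsHistory n ω)) (πν n (obsHistory n ω)) ≤ ε / 2 + M * D n := by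
    refine blDist_le_of_forall (hobs _ _ (D n) fun f hf => ?_)
    obtain ⟨s, hs⟩ := hdense f hf
    exact abs_integral_integral_sub_le_of_dense hc hmeas hn hs
  rw [lt_div_iff₀ hM] at hnM
  linarith
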